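/- Let $\lambda,K>0$, $\beta>2$, $W\ge 0$ and $\gamma\in[0,1]$ with $W>0$ or $\gamma>0$. Let $\Phi=\{X\}$ be a homogeneous Poisson point process on $\mathbb R^2$ of density $\lambda$ and, given $\Phi$, let the marks $(S_X,P_X,T_X)$, $X\in\Phi$, be independent copies of a random vector $(S,P,T)$ with (almost surely) positive coordinates, which need not be independent of each other. Put $$Y_X=\frac{(K|X|)^\beta}{P_XS_X},\qquad I=\sum_{X\in\Phi}Y_X^{-1},\qquad Z_X=\frac{Y_X^{-1}}{W+\gamma(I-Y_X^{-1})},\qquad Z'_X=\frac{Y_X^{-1}}{W+\gamma I}.$$ For $n\ge1$ let $M^{(n)}$ be the $n$th factorial moment measure of the SINR process $\{Z_X\}$, i.e. $M^{(n)}(B)=\mathbf E\sum \mathbf 1\{(Z_{X_1},\dots,Z_{X_n})\in B\}$, the sum being over all ordered $n$-tuples of distinct points of $\Phi$, and write $M^{(n)}(t_1,\dots,t_n)=M^{(n)}((t_1,\infty)\times\dots\times(t_n,\infty))$; define $M'^{(n)}$ in the same way from $\{Z'_X\}$. Let $$\mathcal S_n=\mathbf E\,\#\bigl\{\{X_1,\dots,X_n\}\subset\Phi:\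 X_1,\dots,X_n\text{ distinct},\ Z_{X_i}>T_{X_i}\text{ for }i=1,\dots,n\bigr\}$$ be the expected number of ways of choosing $n$ different base stations each of whose SINR exceeds its own threshold. Assume $\mathbf E[(PS)^{2/\beta}]<\infty$, and let $F_{T^*}$ be the distribution function $$F_{T^*}(t)=\frac{\mathbf E[(PS)^{2/\beta}\mathbf 1(T\le t)]}{\mathbf E[(PS)^{2/\beta}]}.$$ Then $I<\infty$ almost surely, and for every $n\ge1$, as an identity in $[0,\infty]$, $$\mathcal S_n=\frac1{n!}\int_{(0,\infty)^n}\prod_{i=1}^nF_{T^*}(t_i)\,M^{(n)}(dt_1,\dots,dt_n)=\frac1{n!}\int_{(0,\infty)^n}M^{(n)}(t_1,\dots,t_n)\prod_{i=1}^nF_{T^*}(dt_i),$$ where, for all $t_1,\dots,t_n>0$, $M^{(n)}(t_1,\dots,t_n)=M'^{(n)}\bigl(\tfrac{t_1}{1+\gamma t_1},\dots,\tfrac{t_n}{1+\gamma t_n}\bigr)$. -/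

import Mathlib

open MeasureTheory ProbabilityTheory
open scoped ENNReal NNReal

noncomputable section

/-! ### Poisson point processes and factorial moment measures -/

/-- The number of points of the (enumerated) point process `{X i}` that lie in `B`. -/
def pointCount {Ω E : Type*} (X : ℕ → Ω → E) (B : Set E) (ω : Ω) : ℕ∞ :=
  {i : ℕ | X i ω ∈ B}.encard

/-- `X 0, X 1, …` is a measurable enumeration of the points of a Poisson point process with
(infinite) intensity measure `Λ`: the number of points in a set of finite intensity is Poisson
distributed, and the numbers of points in disjoint sets are independent. -/
structure IsPoissonPointProcess {Ω E : Type*} [MeasurableSpace Ω] [MeasurableSpace E]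
    (μ : Measure Ω) (X : ℕ → Ω → E) (Λ : Measure E) : Prop where
  measurable : ∀ i, Measurable (X i)
  poisson : ∀ B : Set E, MeasurableSet B → Λ B ≠ ∞ → ∀ k : ℕ,
    μ {ω | pointCount X B ω = k} = poissonMeasure (Λ B).toNNReal {k}
  indep : ∀ (m : ℕ) (B : Fin m → Set E), (∀ j, MeasurableSet (B j)) →
    Pairwise (fun j l => Disjoint (B j) (B l)) →
    iIndepFun (fun j ω => pointCount X (B j) ω) μ

/-- The `n`-th factorial moment measure of the point process `{Z i}` on `ℝ`:
`B ↦ 𝔼 ∑ 1_B(Z_{i₁}, …, Z_{iₙ})`, the sum being over all ordered `n`-tuples of distinct points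
(see `factorialMomentMeasure_apply`). -/
def factorialMomentMeasure {Ω : Type*} [MeasurableSpace Ω] (μ : Measure Ω) (Z : ℕ → Ω → ℝ)
    (n : ℕ) : Measure (Fin n → ℝ) :=
  Measure.sum fun e : Fin n ↪ ℕ => μ.map fun ω k => Z (e k) ω

theorem factorialMomentMeasure_apply {Ω : Type*} [MeasurableSpace Ω] (μ : Measure Ω)
    (Z : ℕ → Ω → ℝ) (hZ : ∀ i, Measurable (Z i)) (n : ℕ) {B : Set (Fin n → ℝ)}
    (hB : MeasurableSet B) :
    factorialMomentMeasure μ Z n B =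
      ∫⁻ ω, ∑' e : Fin n ↪ ℕ, B.indicator (fun _ => (1 : ℝ≥0∞)) (fun k => Z (e k) ω) ∂μ := by
  have : Countable (Fin n ↪ ℕ) := (DFunLike.coe_injective (F := Fin n ↪ ℕ)).countable
  have hm : ∀ e : Fin n ↪ ℕ, Measurable (fun ω k => Z (e k) ω) := fun e =>
    measurable_pi_lambda _ fun k => hZ (e k)
  have hi : Measurable (B.indicator (fun _ : Fin n → ℝ => (1 : ℝ≥0∞))) :=
    measurable_const.indicator hB
  have hc : ∀ e : Fin n ↪ ℕ, AEMeasurable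
      (fun ω => B.indicator (fun _ => (1 : ℝ≥0∞)) (fun k => Z (e k) ω)) μ := fun e =>
    (hi.comp (hm e)).aemeasurable
  rw [factorialMomentMeasure, Measure.sum_apply _ hB, lintegral_tsum hc]
  refine tsum_congr fun e => ?_
  rw [← lintegral_map hi (hm e), lintegral_indicator_const hB, one_mul]

/-- `M⁽ⁿ⁾(t₁, …, tₙ) = M⁽ⁿ⁾((t₁, ∞) × ⋯ × (tₙ, ∞))`. -/
def factorialMoment {Ω : Type*} [MeasurableSpace Ω] (μ : Measure Ω) (Z : ℕ → Ω → ℝ)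
    (n : ℕ) (t : Fin n → ℝ) : ℝ≥0∞ :=
  factorialMomentMeasure μ Z n {z | ∀ k, t k < z k}

/-! ### The heterogeneous network with varying SINR thresholds -/

/-- A heterogeneous network with varying SINR thresholds on the probability space `(Ω, μ)`. -/
structure HetNetwork {Ω : Type*} [MeasurableSpace Ω] (μ : Measure Ω) where
  /-- density of the base stations -/
  dens : ℝ
  /-- path-loss constant -/
  K : ℝ
  /-- path-loss exponent -/
  β : ℝ
  /-- noise power -/
  W : ℝ
  /-- interference factor -/
  γ : ℝ
  dens_pos : 0 < dens
  K_pos : 0 < K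
  two_lt_β : 2 < β
  W_nonneg : 0 ≤ W
  γ_nonneg : 0 ≤ γ
  γ_le_one : γ ≤ 1
  /-- positions of the base stations -/
  X : ℕ → Ω → EuclideanSpace ℝ (Fin 2)
  /-- propagation effects -/
  S : ℕ → Ω → ℝ
  /-- powers of the base stations -/
  P : ℕ → Ω → ℝ
  /-- SINR thresholds of the base stations -/
  T : ℕ → Ω → ℝ
  /-- the common law of the marks `(S, P, T)` -/
  markLaw : Measure (ℝ × ℝ × ℝ)
  measurable_S : ∀ i, Measurable (S i)
  measurable_P : ∀ i, Measurable (P i)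
  measurable_T : ∀ i, Measurable (T i)
  poisson : IsPoissonPointProcess μ X (ENNReal.ofReal dens • volume)
  marks_law : ∀ i, HasLaw (fun ω => (S i ω, P i ω, T i ω)) markLaw μ
  marks_pos : ∀ᵐ m ∂markLaw, 0 < m.1 ∧ 0 < m.2.1 ∧ 0 < m.2.2
  marks_indep : iIndepFun (fun i ω => (S i ω, P i ω, T i ω)) μ
  marks_indep_X : IndepFun (fun ω i => X i ω) (fun ω i => (S i ω, P i ω, T i ω)) μ

namespace HetNetwork

variable {Ω : Type*} [MeasurableSpace Ω] {μ : Measure Ω}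

/-- The propagation loss `Y = ℓ(|X|) / (P S)` with `ℓ(r) = (K r) ^ β`. -/
def loss (N : HetNetwork μ) (i : ℕ) (ω : Ω) : ℝ :=
  (N.K * ‖N.X i ω‖) ^ N.β / (N.P i ω * N.S i ω)

/-- The power `I = ∑ Y⁻¹` received from the entire network. -/
def totalPower (N : HetNetwork μ) (ω : Ω) : ℝ := ∑' i, (N.loss i ω)⁻¹

/-- The signal-to-interference-and-noise ratio of station `i`. -/
def sinr (N : HetNetwork μ) (i : ℕ) (ω : Ω) : ℝ :=
  (N.loss i ω)⁻¹ / (N.W + N.γ * (N.totalPower ω - (N.loss i ω)⁻¹))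

/-- The signal-to-total-interference-and-noise ratio of station `i`. -/
def stinr (N : HetNetwork μ) (i : ℕ) (ω : Ω) : ℝ :=
  (N.loss i ω)⁻¹ / (N.W + N.γ * N.totalPower ω)

/-- The symmetric sum `𝒮ₙ`: the expected number of ways of choosing `n` different base stations,
each received with a SINR larger than its own threshold. -/
def symmetricSum (N : HetNetwork μ) (n : ℕ) : ℝ≥0∞ :=
  ∫⁻ ω, ∑' s : {s : Finset ℕ // s.card = n},
    {ω' | ∀ i ∈ s.1, N.T i ω' < N.sinr i ω'}.indicator (fun _ => (1 : ℝ≥0∞)) ω ∂μ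

/-- The weight `(P S) ^ (2 / β)` of a mark `(S, P, T)`. -/
def weight (N : HetNetwork μ) (m : ℝ × ℝ × ℝ) : ℝ≥0∞ :=
  ENNReal.ofReal ((m.2.1 * m.1) ^ (2 / N.β))

/-- The moment `𝔼[(P S) ^ (2 / β)]`. -/
def moment (N : HetNetwork μ) : ℝ≥0∞ := ∫⁻ m, N.weight m ∂N.markLaw

/-- The distribution function
`F_{T*}(t) = 𝔼[(P S) ^ (2 / β) 1(T ≤ t)] / 𝔼[(P S) ^ (2 / β)]`. -/
def thresholdCDF (N : HetNetwork μ) (t : ℝ) : ℝ≥0∞ :=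
  (∫⁻ m in {m | m.2.2 ≤ t}, N.weight m ∂N.markLaw) / N.moment

/-- The measure `F_{T*}(dt)`, i.e. the law of `T*`; see `thresholdLaw_Iic`. -/
def thresholdLaw (N : HetNetwork μ) : Measure ℝ :=
  N.moment⁻¹ • (N.markLaw.withDensity N.weight).map fun m => m.2.2

theorem thresholdLaw_Iic (N : HetNetwork μ) (t : ℝ) :
    N.thresholdLaw (Set.Iic t) = N.thresholdCDF t := by
  have hs : MeasurableSet {m : ℝ × ℝ × ℝ | m.2.2 ≤ t} :=
    measurableSet_le (by fun_prop) measurable_const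
  rw [thresholdLaw, thresholdCDF, Measure.smul_apply,
    Measure.map_apply (by fun_prop) measurableSet_Iic]
  change N.moment⁻¹ • (N.markLaw.withDensity N.weight) {m | m.2.2 ≤ t} = _
  rw [withDensity_apply _ hs, smul_eq_mul, mul_comm, ENNReal.div_eq_inv_mul, mul_comm]

theorem measurable_loss (N : HetNetwork μ) (i : ℕ) : Measurable (N.loss i) :=
  (((N.poisson.measurable i).norm.const_mul N.K).pow_const N.β).div
    ((N.measurable_P i).mul (N.measurable_S i))

theorem measurable_totalPower (N : HetNetwork μ) : Measurable N.totalPower :=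
  Measurable.tsum fun j => (N.measurable_loss j).inv

/-- The SINR values are random variables, so the factorial moment measure of the SINR process is
the one described by `factorialMomentMeasure_apply`; likewise for the STINR values. -/
theorem measurable_sinr (N : HetNetwork μ) (i : ℕ) : Measurable (N.sinr i) :=
  (N.measurable_loss i).inv.div
    (((N.measurable_totalPower.sub (N.measurable_loss i).inv).const_mul N.γ).const_add N.W)

theorem measurable_stinr (N : HetNetwork μ) (i : ℕ) : Measurable (N.stinr i) :=
  (N.measurable_loss i).inv.div ((N.measurable_totalPower.const_mul N.γ).const_add N.W)

end HetNetwork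

end

/-!
The argument replaces the dependent thresholds by independent copies of `T*` through a Mecke
formula for the marked Poisson process, in which the points not picked enter only through their
total received power.

*Generating functional.* For a Poisson process `X` with independent marks `m` and a weight
`u ≤ 1`, the mean of `∏ᵢ u (X i, m i)` is `exp (-∫ (1 - u))`. For step functions this is the
generating function of independent Poisson counts, and the general case follows by monotone
limits (`IsPoissonPointProcess.hasPoissonPGFL`, `HasPoissonPGFL.marked`).

*Mecke formula.* Perturbing `u` by `θ` on a set `A` multiplies the functional by `exp (θ ν(A))`,
whereas the product over the points changes, to first order in `θ`, by a sum over one additional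
point in `A`. Differentiating `n` times gives the mean of sums over `n`-tuples of distinct points,
weighted by `u` over the remaining points (`HasPoissonPGFL.lintegral_palmSum`). With
`u = exp (-s V)` this is a Laplace transform in `s` of the sum of `V` over the remaining points;
by uniqueness of Laplace transforms that sum is independent of the picked points, which have
intensity `ν ⊗ ⋯ ⊗ ν`, and is distributed as the full sum (`HasPoissonPGFL.reducedCampbell_eq`).

*The network.* Rescaling the plane by `(P S) ^ (1 / β)` absorbs the mark into the position at the
price of the factor `(P S) ^ (2 / β)`, so that the intensity of the pairs (received power,
threshold) is the product of an atomless measure and the law of `T*`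
(`HetNetwork.map_received`). As the SINR values of a picked tuple are functions of the received
powers of the tuple and of the remaining power, the Mecke formula allows to integrate the
thresholds separately, giving `n! 𝒮ₙ = ∫ ∏ P(T* < z k) M⁽ⁿ⁾(dz)`
(`HetNetwork.factorial_mul_symmetricSum_eq_lintegral`).
Here `P(T* < z)` may be replaced by `F_{T*}(z)`: by the Mecke formula with `n = 1` no SINR value
has an atom in `(0, ∞)`, and `F_{T*}` has only countably many jumps. Tonelli's theorem gives the
second integral. The relation between SINR and STINR is an equivalence of the two inequalities,
valid as soon as all received powers are positive and their sum is finite.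
-/

/-! ### Infinite products of weights in `[0, 1]` -/

/-- The infinite product `∏ᵢ w i` of a sequence of weights in `[0, 1]`, encoded as the infimum of
the finite partial products, so that it always exists. -/
noncomputable def infProd (w : ℕ → ℝ≥0∞) : ℝ≥0∞ := ⨅ N, ∏ i ∈ Finset.range N, w i

theorem antitone_prod_range {w : ℕ → ℝ≥0∞} (hw : ∀ i, w i ≤ 1) :
    Antitone fun N => ∏ i ∈ Finset.range N, w i :=
  antitone_nat_of_succ_le fun N => by
    rw [Finset.prod_range_succ]
    exact mul_le_of_le_one_right' (hw N)

theorem tendsto_infProd {w : ℕ → ℝ≥0∞} (hw : ∀ i, w i ≤ 1) :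
    Filter.Tendsto (fun N => ∏ i ∈ Finset.range N, w i) Filter.atTop (nhds (infProd w)) :=
  tendsto_atTop_iInf (antitone_prod_range hw)

theorem infProd_le (w : ℕ → ℝ≥0∞) (N : ℕ) : infProd w ≤ ∏ i ∈ Finset.range N, w i := iInf_le _ N

theorem infProd_le_one (w : ℕ → ℝ≥0∞) : infProd w ≤ 1 := by simpa using infProd_le w 0

theorem infProd_mono {w w' : ℕ → ℝ≥0∞} (h : ∀ i, w i ≤ w' i) : infProd w ≤ infProd w' :=
  iInf_mono fun _ => Finset.prod_le_prod' fun i _ => h i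

theorem measurable_infProd {α : Type*} [MeasurableSpace α] {w : ℕ → α → ℝ≥0∞}
    (hw : ∀ i, Measurable (w i)) : Measurable fun a => infProd fun i => w i a :=
  Measurable.iInf fun _ => Finset.measurable_fun_prod _ fun i _ => hw i

theorem infProd_prod {ι : Type*} (s : Finset ι) {w : ι → ℕ → ℝ≥0∞} (hw : ∀ j i, w j i ≤ 1) :
    infProd (fun i => ∏ j ∈ s, w j i) = ∏ j ∈ s, infProd (w j) := by
  have h1 : ∀ i, ∏ j ∈ s, w j i ≤ 1 := fun i => Finset.prod_le_one' fun j _ => hw j i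
  refine tendsto_nhds_unique (tendsto_infProd h1) ?_
  simp_rw [Finset.prod_comm (s := Finset.range _)]
  exact ENNReal.tendsto_finsetProd_of_ne_top s (fun j _ => tendsto_infProd (hw j))
    fun j _ => ((infProd_le_one _).trans_lt ENNReal.one_lt_top).ne

theorem iInf_infProd {u : ℕ → ℕ → ℝ≥0∞} (hu : ∀ k i, u k i ≤ 1) (ha : Antitone u) :
    ⨅ k, infProd (u k) = infProd fun i => ⨅ k, u k i := by
  unfold infProd
  rw [iInf_comm]
  refine iInf_congr fun N => ?_
  have hanti : Antitone fun k => ∏ i ∈ Finset.range N, u k i := fun k l hkl =>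
    Finset.prod_le_prod' fun i _ => ha hkl i
  refine tendsto_nhds_unique (tendsto_atTop_iInf hanti) ?_
  refine ENNReal.tendsto_finsetProd_of_ne_top _
    (fun i _ => tendsto_atTop_iInf fun k l hkl => ha hkl i) fun i _ => ?_
  exact ((iInf_le _ 0).trans_lt ((hu 0 i).trans_lt ENNReal.one_lt_top)).ne

open scoped Classical in
theorem infProd_ite {S : Set ℕ} (hS : S.Finite) {z : ℝ≥0∞} (hz : z ≤ 1) :
    infProd (fun i => if i ∈ S then z else 1) = z ^ S.ncard := by
  have hw : ∀ i, (if i ∈ S then z else 1) ≤ 1 := fun i => by split_ifs <;> simp [hz]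
  obtain ⟨N, hN⟩ := hS.bddAbove
  refine tendsto_nhds_unique (tendsto_infProd hw) ?_
  refine Filter.Tendsto.congr' (f₁ := fun _ => z ^ S.ncard) ?_ tendsto_const_nhds
  filter_upwards [Filter.eventually_gt_atTop N] with M hM
  rw [Finset.prod_ite, Finset.prod_const, Finset.prod_const_one, mul_one,
    ← Set.ncard_coe_finset]
  congr 2
  ext i
  simp only [Finset.coe_filter, Finset.mem_range, Set.mem_ofPred_eq]
  exact ⟨fun hi => ⟨(hN hi).trans_lt hM, hi⟩, fun hi => hi.2⟩

theorem prod_range_update_self (x : ℕ → ℝ≥0∞) (N : ℕ) :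
    ∏ j ∈ Finset.range (N + 1), Function.update x N 1 j = ∏ j ∈ Finset.range N, x j := by
  rw [Finset.prod_range_succ, Function.update_self, mul_one]
  refine Finset.prod_congr rfl fun j hj => ?_
  rw [Function.update_of_ne (Finset.mem_range.1 hj).ne]

theorem prod_range_add_ge (x b : ℕ → ℝ≥0∞) (N : ℕ) :
    ∏ i ∈ Finset.range N, x i +
        ∑ i ∈ Finset.range N, b i * ∏ j ∈ Finset.range N, Function.update x i 1 j ≤
      ∏ i ∈ Finset.range N, (x i + b i) := by
  induction N with
  | zero => simp
  | succ N ih =>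
    rw [Finset.prod_range_succ (fun i => x i + b i), Finset.sum_range_succ, prod_range_update_self]
    have h1 : ∑ i ∈ Finset.range N, b i * ∏ j ∈ Finset.range (N + 1), Function.update x i 1 j =
        (∑ i ∈ Finset.range N, b i * ∏ j ∈ Finset.range N, Function.update x i 1 j) * x N := by
      rw [Finset.sum_mul]
      refine Finset.sum_congr rfl fun i hi => ?_
      rw [Finset.prod_range_succ, Function.update_of_ne (Finset.mem_range.1 hi).ne', mul_assoc]
    rw [h1, Finset.prod_range_succ, mul_add, ← add_assoc, ← add_mul, mul_comm (b N)]
    gcongr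
    exact le_self_add

theorem prod_range_add_le (x b : ℕ → ℝ≥0∞) (N : ℕ) :
    ∏ i ∈ Finset.range N, (x i + b i) ≤
      ∏ i ∈ Finset.range N, x i +
        ∑ i ∈ Finset.range N,
          b i * ∏ j ∈ Finset.range N, Function.update (fun i => x i + b i) i 1 j := by
  induction N with
  | zero => simp
  | succ N ih =>
    rw [Finset.prod_range_succ (fun i => x i + b i), Finset.sum_range_succ, prod_range_update_self]
    have h1 : ∑ i ∈ Finset.range N,
          b i * ∏ j ∈ Finset.range (N + 1), Function.update (fun i => x i + b i) i 1 j =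
        (∑ i ∈ Finset.range N,
          b i * ∏ j ∈ Finset.range N, Function.update (fun i => x i + b i) i 1 j) *
            (x N + b N) := by
      rw [Finset.sum_mul]
      refine Finset.sum_congr rfl fun i hi => ?_
      rw [Finset.prod_range_succ, Function.update_of_ne (Finset.mem_range.1 hi).ne', mul_assoc]
    rw [h1, Finset.prod_range_succ, mul_add, ← add_assoc, mul_comm (b N)]
    gcongr
    refine (mul_le_mul_left ih _).trans ?_
    rw [add_mul]
    gcongr
    exact le_self_add

/-- First-order lower bound for the change of an infinite product when a perturbation `b` is added:
in the `i`-th term the factor at `i` is replaced by `b i`, the others are left unperturbed. -/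
theorem infProd_add_ge {x b : ℕ → ℝ≥0∞} (h : ∀ i, x i + b i ≤ 1) :
    infProd x + ∑' i, b i * infProd (Function.update x i 1) ≤ infProd fun i => x i + b i := by
  rw [ENNReal.tsum_eq_iSup_nat, ENNReal.add_iSup]
  refine iSup_le fun M => ge_of_tendsto (tendsto_infProd h) ?_
  filter_upwards [Filter.eventually_ge_atTop M] with N hN
  refine le_trans ?_ (prod_range_add_ge x b N)
  refine add_le_add (infProd_le _ _) ?_
  refine (Finset.sum_le_sum fun i _ => ?_).trans
    (Finset.sum_le_sum_of_subset (Finset.range_mono hN))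
  gcongr
  exact infProd_le _ _

/-- The companion upper bound, in which the other factors are perturbed as well. -/
theorem infProd_add_le {x b : ℕ → ℝ≥0∞} (h : ∀ i, x i + b i ≤ 1) (hb : {i | b i ≠ 0}.Finite) :
    infProd (fun i => x i + b i) ≤
      infProd x + ∑' i, b i * infProd (Function.update (fun i => x i + b i) i 1) := by
  have hx : ∀ i, x i ≤ 1 := fun i => le_self_add.trans (h i)
  have hu : ∀ i j, Function.update (fun i => x i + b i) i 1 j ≤ 1 := fun i j => by
    rcases eq_or_ne j i with rfl | hj
    · simp
    · simpa [Function.update_of_ne hj] using h j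
  obtain ⟨M, hM⟩ := hb.bddAbove
  have hzero : ∀ i ∉ Finset.range (M + 1), b i = 0 := fun i hi => by
    by_contra h0
    exact hi (Finset.mem_range.2 (Nat.lt_succ_of_le (hM h0)))
  rw [tsum_eq_sum (s := Finset.range (M + 1)) fun i hi => by rw [hzero i hi, zero_mul]]
  refine le_of_tendsto_of_tendsto (tendsto_infProd h) ((tendsto_infProd hx).add
    (tendsto_finsetSum _ fun i _ => ENNReal.Tendsto.const_mul (tendsto_infProd (hu i))
      (Or.inr ((le_self_add.trans ((add_comm _ _).trans_le (h i))).trans_lt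
        ENNReal.one_lt_top).ne))) ?_
  filter_upwards [Filter.eventually_ge_atTop (M + 1)] with N hN
  refine (prod_range_add_le x b N).trans (add_le_add le_rfl ?_)
  refine (Finset.sum_subset (Finset.range_mono hN) fun i _ hi => ?_).ge
  rw [hzero i hi, zero_mul]

/-! ### The generating functional of a marked Poisson process -/

/-- `ξ 0, ξ 1, …` has the probability generating functional of a Poisson process of intensity
`ν`: `𝔼 ∏ᵢ u (ξ i) = exp (-∫ (1 - u) dν)` for measurable `u ≤ 1` with `∫ (1 - u) dν < ∞`. -/
def HasPoissonPGFL {Ω E : Type*} [MeasurableSpace Ω] [MeasurableSpace E]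
    (μ : Measure Ω) (ξ : ℕ → Ω → E) (ν : Measure E) : Prop :=
  ∀ u : E → ℝ≥0∞, Measurable u → (∀ x, u x ≤ 1) → ∫⁻ x, (1 - u x) ∂ν ≠ ∞ →
    ∫⁻ ω, infProd (fun i => u (ξ i ω)) ∂μ =
      ENNReal.ofReal (Real.exp (-(∫⁻ x, (1 - u x) ∂ν).toReal))

open scoped Classical in
theorem infProd_ite_eq_pow_pointCount {Ω E : Type*} {X : ℕ → Ω → E} {B : Set E} {ω : Ω}
    (hω : pointCount X B ω ≠ ⊤)
    {z : ℝ≥0∞} (hz : z ≤ 1) :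
    infProd (fun i => if X i ω ∈ B then z else 1) = z ^ (pointCount X B ω).toNat :=
  infProd_ite (S := {i | X i ω ∈ B}) (Set.encard_ne_top_iff.1 hω) hz

section counts

variable {Ω E : Type*} [MeasurableSpace Ω] [MeasurableSpace E] {μ : Measure Ω}
  {X : ℕ → Ω → E} {Λ : Measure E}

theorem measurable_pointCount (hX : ∀ i, Measurable (X i)) {B : Set E} (hB : MeasurableSet B) :
    Measurable (pointCount X B) := by
  refine measurable_to_countable' fun k => ?_
  have hle : ∀ k : ℕ∞, MeasurableSet {ω | k ≤ pointCount X B ω} := by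
    intro k
    induction k with
    | top =>
      have : {ω | (⊤ : ℕ∞) ≤ pointCount X B ω} =
          ⋂ N : ℕ, ⋃ i : ℕ, ⋃ _ : N ≤ i, X i ⁻¹' B := by
        ext ω
        simp only [Set.mem_ofPred_eq, top_le_iff, pointCount, Set.encard_eq_top_iff, Set.mem_iInter,
          Set.mem_iUnion, Set.mem_preimage]
        rw [← Nat.frequently_atTop_iff_infinite, Filter.frequently_atTop]
        simp
      rw [this]
      exact MeasurableSet.iInter fun N => MeasurableSet.iUnion fun i => MeasurableSet.iUnion
        fun _ => hX i hB
    | coe k =>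
      have : {ω | (k : ℕ∞) ≤ pointCount X B ω} =
          ⋃ s : Finset ℕ, ⋃ _ : s.card = k, ⋂ i ∈ s, X i ⁻¹' B := by
        ext ω
        simp only [Set.mem_ofPred_eq, pointCount, Set.mem_iUnion, Set.mem_iInter, Set.mem_preimage]
        constructor
        · intro h
          obtain ⟨t, ht, htk⟩ := Set.exists_subset_encard_eq h
          have hfin : t.Finite := Set.finite_of_encard_eq_coe htk
          refine ⟨hfin.toFinset, ?_, fun i hi => ht (hfin.mem_toFinset.1 hi)⟩
          rw [hfin.encard_eq_coe_toFinset_card] at htk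
          exact_mod_cast htk
        · rintro ⟨s, hs, h⟩
          rw [← hs, ← Set.encard_coe_eq_coe_finsetCard]
          exact Set.encard_le_encard fun i hi => h i hi
      rw [this]
      exact MeasurableSet.iUnion fun s => MeasurableSet.iUnion fun _ =>
        Finset.measurableSet_biInter s fun i _ => hX i hB
  have : pointCount X B ⁻¹' {k} = {ω | k ≤ pointCount X B ω} \
      {ω | k + 1 ≤ pointCount X B ω ∧ k ≠ ⊤} := by
    ext ω
    simp only [Set.mem_preimage, Set.mem_singleton_iff, Set.mem_sdiff, Set.mem_ofPred_eq]
    rcases eq_or_ne k ⊤ with rfl | hk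
    · simp
    · rw [ENat.add_one_le_iff hk]
      simp only [hk, ne_eq, not_false_eq_true, and_true, not_lt]
      exact ⟨fun h => h ▸ ⟨le_rfl, le_rfl⟩, fun h => le_antisymm h.2 h.1⟩
  rw [this]
  refine (hle k).diff ?_
  by_cases hk : k = ⊤
  · simp [hk]
  · simpa [hk] using hle (k + 1)

/-- The Poisson probabilities of the finite values already sum to one. -/
theorem IsPoissonPointProcess.ae_pointCount_ne_top [IsProbabilityMeasure μ]
    (h : IsPoissonPointProcess μ X Λ) {B : Set E} (hB : MeasurableSet B) (hΛ : Λ B ≠ ∞) :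
    ∀ᵐ ω ∂μ, pointCount X B ω ≠ ⊤ := by
  have hm := measurable_pointCount h.measurable hB
  have hmk : ∀ k : ℕ, MeasurableSet {ω | pointCount X B ω = k} := fun k =>
    hm (measurableSet_singleton (k : ℕ∞))
  have hs : MeasurableSet (⋃ k : ℕ, {ω | pointCount X B ω = k}) := MeasurableSet.iUnion hmk
  have h1 : μ (⋃ k : ℕ, {ω | pointCount X B ω = k}) = 1 := by
    rw [measure_iUnion (fun k l hkl => Set.disjoint_left.2 fun ω hk hl => hkl ?_) hmk]
    · simp_rw [h.poisson B hB hΛ]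
      have := Measure.tsum_indicator_apply_singleton (poissonMeasure (Λ B).toNNReal) Set.univ
        MeasurableSet.univ
      simpa using this
    · have hk' : pointCount X B ω = k := hk
      rw [show pointCount X B ω = l from hl] at hk'
      exact_mod_cast hk'.symm
  filter_upwards [(mem_ae_iff_prob_eq_one hs).2 h1] with ω hω
  obtain ⟨k, hk⟩ := Set.mem_iUnion.1 hω
  rw [show pointCount X B ω = k from hk]
  exact ENat.natCast_ne_top k

/-- The generating function of a Poisson variable. -/
theorem IsPoissonPointProcess.lintegral_pow_pointCount [IsProbabilityMeasure μ]
    (h : IsPoissonPointProcess μ X Λ) {B : Set E} (hB : MeasurableSet B) (hΛ : Λ B ≠ ∞)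
    {z : ℝ≥0∞} (hz : z ≤ 1) :
    ∫⁻ ω, z ^ (pointCount X B ω).toNat ∂μ =
      ENNReal.ofReal (Real.exp (-(Λ B * (1 - z)).toReal)) := by
  have hm : Measurable fun ω => (pointCount X B ω).toNat :=
    (measurable_from_top (f := ENat.toNat)).comp (measurable_pointCount h.measurable hB)
  have hN : μ.map (fun ω => (pointCount X B ω).toNat) = poissonMeasure (Λ B).toNNReal := by
    refine Measure.ext_of_singleton fun k => ?_
    rw [Measure.map_apply hm (measurableSet_singleton _), ← h.poisson B hB hΛ k]
    refine measure_congr ?_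
    filter_upwards [h.ae_pointCount_ne_top hB hΛ] with ω hω
    refine propext ?_
    change (pointCount X B ω).toNat = k ↔ pointCount X B ω = k
    lift pointCount X B ω to ℕ using hω with m
    simp
  have hz' : z ≠ ∞ := (hz.trans_lt ENNReal.one_lt_top).ne
  rw [← lintegral_map (f := fun k : ℕ => z ^ k) (measurable_of_countable _) hm, hN, lintegral_countable']
  lift z to ℝ≥0 using hz'
  simp_rw [poissonMeasure_singleton]
  have hz1 : z ≤ 1 := by exact_mod_cast hz
  set L := (Λ B).toNNReal with hL
  have hLB : Λ B = L := (ENNReal.coe_toNNReal hΛ).symm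
  have hr : (Λ B * (1 - (z : ℝ≥0∞))).toReal = L * (1 - z) := by
    rw [hLB, ENNReal.toReal_mul, ENNReal.toReal_sub_of_le (by exact_mod_cast hz1) (by simp)]
    simp
  rw [hr]
  have hterm : ∀ k : ℕ, (z : ℝ≥0∞) ^ k * ENNReal.ofReal (Real.exp (-L) * L ^ k / k.factorial) =
      ENNReal.ofReal (Real.exp (-L) * ((z * L) ^ k / k.factorial)) := fun k => by
    rw [← ENNReal.ofReal_coe_nnreal, ← ENNReal.ofReal_pow z.coe_nonneg, ← ENNReal.ofReal_mul (by positivity)]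
    congr 1
    rw [mul_pow]
    ring
  simp_rw [hterm]
  have hs : HasSum (fun k : ℕ => Real.exp (-L) * ((z * L : ℝ) ^ k / k.factorial))
      (Real.exp (-L) * Real.exp (z * L)) := by
    refine HasSum.mul_left _ ?_
    rw [Real.exp_eq_exp_ℝ]
    exact NormedSpace.expSeries_div_hasSum_exp _
  rw [← ENNReal.ofReal_tsum_of_nonneg (fun k => by positivity) hs.summable, hs.tsum_eq,
    ← Real.exp_add]
  congr 2
  ring

/-- For a simple function the generating functional is a product of generating functions of
independent Poisson counts, one for each level set. -/
theorem IsPoissonPointProcess.lintegral_infProd_simpleFunc [IsProbabilityMeasure μ]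
    (h : IsPoissonPointProcess μ X Λ) (f : SimpleFunc E ℝ≥0∞) (hf : ∀ x, f x ≤ 1)
    (hint : ∫⁻ x, f x ∂Λ ≠ ∞) :
    ∫⁻ ω, infProd (fun i => 1 - f (X i ω)) ∂μ =
      ENNReal.ofReal (Real.exp (-(∫⁻ x, f x ∂Λ).toReal)) := by
  classical
  set s : Finset ℝ≥0∞ := f.range.erase 0 with hs
  let c : Fin s.card → ℝ≥0∞ := fun j => (s.equivFin.symm j : ℝ≥0∞)
  have hc0 : ∀ j, c j ≠ 0 := fun j => (Finset.mem_erase.1 (s.equivFin.symm j).2).1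
  have hc1 : ∀ j, c j ≤ 1 := fun j => by
    obtain ⟨x, hx⟩ := SimpleFunc.mem_range.1 (Finset.mem_erase.1 (s.equivFin.symm j).2).2
    exact hx.symm.trans_le (hf x)
  have hcinj : Function.Injective c := fun j l hjl => by
    simpa [c] using hjl
  let B : Fin s.card → Set E := fun j => f ⁻¹' {c j}
  have hB : ∀ j, MeasurableSet (B j) := fun j => f.measurableSet_preimage _
  have hdisj : Pairwise fun j l => Disjoint (B j) (B l) := fun j l hjl =>
    Disjoint.preimage _ (Set.disjoint_singleton.2 (hcinj.ne hjl))
  have hsum : ∀ g : ℝ≥0∞ → ℝ≥0∞, ∑ j, g (c j) = ∑ a ∈ s, g a := fun g => by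
    rw [← Finset.sum_coe_sort s]
    exact Equiv.sum_comp s.equivFin.symm fun a : s => g a
  have hprod : ∀ g : ℝ≥0∞ → ℝ≥0∞, ∏ j, g (c j) = ∏ a ∈ s, g a := fun g => by
    rw [← Finset.prod_coe_sort s]
    exact Equiv.prod_comp s.equivFin.symm fun a : s => g a
  have hlint : ∫⁻ x, f x ∂Λ = ∑ j, c j * Λ (B j) := by
    refine (SimpleFunc.lintegral_eq_lintegral f Λ).trans ?_
    change ∑ a ∈ f.range, a * Λ (f ⁻¹' {a}) = _
    rw [hsum fun a => a * Λ (f ⁻¹' {a})]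
    by_cases h0 : (0 : ℝ≥0∞) ∈ f.range
    · rw [← Finset.add_sum_erase _ _ h0, zero_mul, zero_add]
    · rw [hs, Finset.erase_eq_of_notMem h0]
  have hΛ : ∀ j, Λ (B j) ≠ ∞ := fun j hj => by
    refine hint (hlint.trans (ENNReal.sum_eq_top.2 ⟨j, Finset.mem_univ _, ?_⟩))
    rw [hj, ENNReal.mul_top (hc0 j)]
  have hfac : ∀ x, 1 - f x = ∏ j, if x ∈ B j then 1 - c j else 1 := fun x => by
    have hj : ∀ j, (if x ∈ B j then 1 - c j else 1) = if f x = c j then 1 - c j else 1 :=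
      fun j => if_congr Iff.rfl rfl rfl
    rw [Finset.prod_congr rfl fun j _ => hj j, hprod fun a => if f x = a then 1 - a else 1, Finset.prod_ite_eq]
    by_cases h0 : f x = 0
    · simp [h0]
    · rw [if_pos (Finset.mem_erase.2 ⟨h0, SimpleFunc.mem_range_self f x⟩)]
  have hle : ∀ j, 1 - c j ≤ 1 := fun j => tsub_le_self
  have hcount : ∀ᵐ ω ∂μ, ∀ j, pointCount X (B j) ω ≠ ⊤ :=
    ae_all_iff.2 fun j => h.ae_pointCount_ne_top (hB j) (hΛ j)
  have hae : ∀ᵐ ω ∂μ, infProd (fun i => 1 - f (X i ω)) =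
      ∏ j, (1 - c j) ^ (pointCount X (B j) ω).toNat := by
    filter_upwards [hcount] with ω hω
    simp_rw [hfac]
    rw [infProd_prod Finset.univ (w := fun j i => if X i ω ∈ B j then 1 - c j else 1)
      fun j i => by split_ifs <;> simp]
    exact Finset.prod_congr rfl fun j _ => infProd_ite_eq_pow_pointCount (hω j) (hle j)
  have hind : iIndepFun (fun j ω => (1 - c j) ^ (pointCount X (B j) ω).toNat) μ :=
    (h.indep s.card B hB hdisj).comp (fun j k => (1 - c j) ^ k.toNat) fun j => measurable_from_top
  rw [lintegral_congr_ae hae, lintegral_prod_eq_prod_lintegral_of_indepFun _ _ hind fun j =>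
    (measurable_from_top (f := fun k : ℕ∞ => (1 - c j) ^ k.toNat)).comp
      (measurable_pointCount h.measurable (hB j))]
  simp_rw [fun j => h.lintegral_pow_pointCount (hB j) (hΛ j) (hle j)]
  rw [← ENNReal.ofReal_prod_of_nonneg fun j _ => (Real.exp_pos _).le, ← Real.exp_sum,
    Finset.sum_neg_distrib, hlint, ENNReal.toReal_sum fun j _ =>
      ENNReal.mul_ne_top ((hc1 j).trans_lt ENNReal.one_lt_top).ne (hΛ j)]
  congr 4
  ext j
  rw [ENNReal.sub_sub_cancel ENNReal.one_ne_top (hc1 j), mul_comm]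

/-- The general case follows from simple functions by approximating `1 - u` from below. -/
theorem IsPoissonPointProcess.hasPoissonPGFL [IsProbabilityMeasure μ]
    (h : IsPoissonPointProcess μ X Λ) : HasPoissonPGFL μ X Λ := by
  intro u hu hu1 hint
  set f : E → ℝ≥0∞ := fun x => 1 - u x with hf
  have hfm : Measurable f := measurable_const.sub hu
  let F : ℕ → SimpleFunc E ℝ≥0∞ := SimpleFunc.eapprox f
  have hsup : ∀ x, ⨆ k, F k x = f x := SimpleFunc.iSup_eapprox_apply hfm
  have hF : ∀ k x, F k x ≤ f x := fun k x => hsup x ▸ le_iSup (fun k => F k x) k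
  have hmono : Monotone fun k x => F k x := fun k l hkl x => SimpleFunc.monotone_eapprox f hkl x
  have hF1 : ∀ k x, F k x ≤ 1 := fun k x => (hF k x).trans tsub_le_self
  have hu' : ∀ x, u x = ⨅ k, (1 - F k x) := fun x => by
    rw [← ENNReal.sub_iSup ENNReal.one_ne_top, hsup x, hf,
      ENNReal.sub_sub_cancel ENNReal.one_ne_top (hu1 x)]
  have hanti : ∀ ω, Antitone fun k i => 1 - F k (X i ω) := fun ω k l hkl i =>
    tsub_le_tsub_left (hmono hkl _) 1
  have hFint : ∀ k, ∫⁻ x, F k x ∂Λ ≠ ∞ := fun k => ne_top_of_le_ne_top hint (lintegral_mono (hF k))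
  have hone : ∀ k, Measurable fun x => 1 - F k x := fun k =>
    measurable_const.sub (F k).measurable
  have hlhs : ∫⁻ ω, infProd (fun i => u (X i ω)) ∂μ =
      ⨅ k, ENNReal.ofReal (Real.exp (-(∫⁻ x, F k x ∂Λ).toReal)) := by
    simp_rw [hu', ← fun ω => iInf_infProd (u := fun k i => 1 - F k (X i ω))
      (fun k i => tsub_le_self) (hanti ω)]
    rw [lintegral_iInf
      (fun k => measurable_infProd (w := fun i ω => 1 - F k (X i ω))
        fun i => (hone k).comp (h.measurable i))
      (fun k l hkl ω => infProd_mono fun i => hanti ω hkl i)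
      (ne_top_of_le_ne_top (by simp : ∫⁻ _, 1 ∂μ ≠ ∞)
        (lintegral_mono fun ω => infProd_le_one _))]
    exact iInf_congr fun k => h.lintegral_infProd_simpleFunc (F k) (hF1 k) (hFint k)
  have hlim : Filter.Tendsto (fun k => ∫⁻ x, F k x ∂Λ) Filter.atTop (nhds (∫⁻ x, f x ∂Λ)) := by
    have : ∫⁻ x, f x ∂Λ = ⨆ k, ∫⁻ x, F k x ∂Λ := by
      rw [← lintegral_iSup (fun k => (F k).measurable) hmono]
      exact lintegral_congr fun x => (hsup x).symm
    rw [this]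
    exact tendsto_atTop_iSup fun k l hkl => lintegral_mono (hmono hkl)
  rw [hlhs]
  refine tendsto_nhds_unique (tendsto_atTop_iInf fun k l hkl => ?_)
    (ENNReal.tendsto_ofReal (((ENNReal.tendsto_toReal hint).comp hlim).neg.rexp))
  gcongr
  · exact hFint l
  · exact hmono hkl _

end counts

section marks

variable {Ω E F : Type*} [MeasurableSpace Ω] [MeasurableSpace E] [MeasurableSpace F]
  {μ : Measure Ω} {X : ℕ → Ω → E} {m : ℕ → Ω → F} {Λ : Measure E} {Q : Measure F}

/-- Marking: averaging over independent marks replaces `u` by its mean over the mark law. -/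
theorem HasPoissonPGFL.marked [IsProbabilityMeasure μ] [SFinite Λ] [IsProbabilityMeasure Q]
    (h : HasPoissonPGFL μ X Λ) (hX : ∀ i, Measurable (X i)) (hm : ∀ i, Measurable (m i))
    (hlaw : ∀ i, μ.map (m i) = Q) (hind : iIndepFun m μ)
    (hindX : IndepFun (fun ω i => X i ω) (fun ω i => m i ω) μ) :
    HasPoissonPGFL μ (fun i ω => (X i ω, m i ω)) (Λ.prod Q) := by
  intro u hu hu1 hint
  have hXm : Measurable fun ω i => X i ω := measurable_pi_lambda _ hX
  have hmm : Measurable fun ω i => m i ω := measurable_pi_lambda _ hm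
  set v : E → ℝ≥0∞ := fun x => ∫⁻ y, u (x, y) ∂Q with hv
  have hvm : Measurable v := hu.lintegral_prod_right'
  have hv1 : ∀ x, v x ≤ 1 := fun x => by
    calc v x ≤ ∫⁻ _, 1 ∂Q := lintegral_mono fun y => hu1 _
      _ = 1 := by simp
  have hvint : ∫⁻ x, (1 - v x) ∂Λ = ∫⁻ p, (1 - u p) ∂(Λ.prod Q) := by
    rw [lintegral_prod _ (by fun_prop)]
    refine lintegral_congr fun x => ?_
    rw [lintegral_sub (by fun_prop) (ne_top_of_le_ne_top ENNReal.one_ne_top (hv1 x))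
      (Filter.Eventually.of_forall fun y => hu1 _)]
    simp [hv]
  have hfin : ∀ N, ∫⁻ ω, ∏ i ∈ Finset.range N, u (X i ω, m i ω) ∂μ =
      ∫⁻ ω, ∏ i ∈ Finset.range N, v (X i ω) ∂μ := by
    intro N
    have hjm : Measurable fun p : (ℕ → E) × (ℕ → F) =>
        ∏ i ∈ Finset.range N, u (p.1 i, p.2 i) :=
      Finset.measurable_fun_prod _ fun i _ => hu.comp (by fun_prop)
    rw [← lintegral_map (f := fun p : (ℕ → E) × (ℕ → F) =>
        ∏ i ∈ Finset.range N, u (p.1 i, p.2 i)) hjm (hXm.prodMk hmm),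
      (indepFun_iff_map_prod_eq_prod_map_map hXm.aemeasurable hmm.aemeasurable).1 hindX]
    have := Measure.isProbabilityMeasure_map (μ := μ) hmm.aemeasurable
    rw [lintegral_prod _ hjm.aemeasurable, lintegral_map hjm.lintegral_prod_right' hXm]
    refine lintegral_congr fun ω => ?_
    rw [lintegral_map (by fun_prop) hmm]
    have hi : iIndepFun (fun i ω' => u (X i ω, m i ω')) μ :=
      hind.comp (fun i y => u (X i ω, y)) fun i => hu.comp (by fun_prop)
    rw [lintegral_prod_eq_prod_lintegral_of_indepFun _ _ hi fun i => hu.comp (by fun_prop)]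
    refine Finset.prod_congr rfl fun i _ => ?_
    rw [hv, ← hlaw i]
    exact (lintegral_map (f := fun y => u (X i ω, y)) (by fun_prop) (hm i)).symm
  rw [← hvint, ← h v hvm hv1 (hvint ▸ hint)]
  have key : ∀ w : ℕ → Ω → ℝ≥0∞, (∀ i, Measurable (w i)) → (∀ i ω, w i ω ≤ 1) →
      ∫⁻ ω, infProd (fun i => w i ω) ∂μ = ⨅ N, ∫⁻ ω, ∏ i ∈ Finset.range N, w i ω ∂μ :=
    fun w hw hw1 => lintegral_iInf (fun N => Finset.measurable_fun_prod _ fun i _ => hw i)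
      (fun N M hNM ω => antitone_prod_range (fun i => hw1 i ω) hNM) (by simp)
  rw [key (fun i ω => u (X i ω, m i ω)) (fun i => hu.comp ((hX i).prodMk (hm i)))
    fun i ω => hu1 _, key (fun i ω => v (X i ω)) (fun i => hvm.comp (hX i)) fun i ω => hv1 _]
  exact iInf_congr hfin

theorem HasPoissonPGFL.map {G : E → F} (h : HasPoissonPGFL μ X Λ) (hG : Measurable G) :
    HasPoissonPGFL μ (fun i ω => G (X i ω)) (Λ.map G) := by
  intro u hu hu1 hint
  rw [lintegral_map (by fun_prop) hG] at hint ⊢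
  exact h (u ∘ G) (hu.comp hG) (fun x => hu1 _) hint

end marks

/-! ### Sums over tuples of distinct points -/

instance countable_finEmbeddingNat (n : ℕ) : Countable (Fin n ↪ ℕ) :=
  (DFunLike.coe_injective (F := Fin n ↪ ℕ)).countable

open scoped Classical in
/-- The weight `∏ u (x i)` over all indices `i` that are not among the values of `e`. -/
noncomputable def restProd {E : Type*} (x : ℕ → E) {n : ℕ} (e : Fin n ↪ ℕ) (u : E → ℝ≥0∞) :
    ℝ≥0∞ :=
  infProd fun i => if i ∈ Set.range e then 1 else u (x i)

/-- The sum `∑ ∏ₖ 1(x (e k) ∈ A k) ∏_{i ∉ e} u (x i)` over the ordered `n`-tuples `e` of distinct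
indices; its mean determines the reduced `n`-fold Campbell measure. -/
noncomputable def palmSum {E : Type*} (x : ℕ → E) {n : ℕ} (A : Fin n → Set E) (u : E → ℝ≥0∞) :
    ℝ≥0∞ :=
  ∑' e : Fin n ↪ ℕ, (∏ k, (A k).indicator 1 (x (e k))) * restProd x e u

section pointwise

variable {E : Type*} {x : ℕ → E} {n : ℕ} {u : E → ℝ≥0∞}

theorem range_embeddingFinSucc_symm (e : Fin n ↪ ℕ) (i : {i // i ∉ Set.range e}) :
    Set.range ((Equiv.embeddingFinSucc n ℕ).symm ⟨e, i⟩) = insert i.1 (Set.range e) := by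
  rw [Equiv.coe_embeddingFinSucc_symm, Fin.range_cons]

open scoped Classical in
theorem restProd_embeddingFinSucc_symm (e : Fin n ↪ ℕ) (i : {i // i ∉ Set.range e}) :
    restProd x ((Equiv.embeddingFinSucc n ℕ).symm ⟨e, i⟩) u =
      infProd (Function.update (fun j => if j ∈ Set.range e then 1 else u (x j)) i.1 1) := by
  unfold restProd
  congr 1
  ext j
  have hmem : j ∈ Set.range ((Equiv.embeddingFinSucc n ℕ).symm ⟨e, i⟩) ↔
      j = i.1 ∨ j ∈ Set.range e := by
    rw [range_embeddingFinSucc_symm, Set.mem_insert_iff]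
  rcases eq_or_ne j i.1 with hj | hj
  · rw [if_pos (hmem.2 (Or.inl hj)), hj, Function.update_self]
  · rw [Function.update_of_ne hj]
    exact if_congr (hmem.trans (or_iff_right hj)) rfl rfl

open scoped Classical in
/-- Splitting off the first index of an `(n + 1)`-tuple. -/
theorem palmSum_cons (A : Fin n → Set E) (B : Set E) :
    palmSum x (Fin.cons B A : Fin (n + 1) → Set E) u =
      ∑' e : Fin n ↪ ℕ, (∏ k, (A k).indicator 1 (x (e k))) *
        ∑' i : ℕ, (if i ∈ Set.range e then 0 else B.indicator 1 (x i)) *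
          infProd (Function.update (fun j => if j ∈ Set.range e then 1 else u (x j)) i 1) := by
  unfold palmSum
  rw [← (Equiv.embeddingFinSucc n ℕ).symm.tsum_eq, ENNReal.tsum_sigma']
  refine tsum_congr fun e => ?_
  rw [← ENNReal.tsum_mul_left]
  rw [← tsum_subtype_eq_of_support_subset (s := {i | i ∉ Set.range e})]
  · refine tsum_congr fun i => ?_
    rw [restProd_embeddingFinSucc_symm, Fin.prod_univ_succ, if_neg i.2]
    have h0 : (Equiv.embeddingFinSucc n ℕ).symm ⟨e, i⟩ 0 = i.1 := by
      rw [Equiv.coe_embeddingFinSucc_symm]; rfl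
    have hk : ∀ k : Fin n, (Equiv.embeddingFinSucc n ℕ).symm ⟨e, i⟩ k.succ = e k := fun k => by
      rw [Equiv.coe_embeddingFinSucc_symm]; rfl
    simp only [h0, hk, Fin.cons_zero, Fin.cons_succ]
    ring
  · intro i hi hmem
    exact hi (by simp only [hmem, if_true, zero_mul, mul_zero])

theorem palmSum_add_ge (A : Fin n → Set E) (B : Set E) {θ : ℝ≥0∞}
    (h : ∀ y, u y + θ * B.indicator 1 y ≤ 1) :
    palmSum x A u + θ * palmSum x (Fin.cons B A : Fin (n + 1) → Set E) u ≤
      palmSum x A fun y => u y + θ * B.indicator 1 y := by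
  classical
  rw [palmSum_cons, ← ENNReal.tsum_mul_left]
  unfold palmSum
  rw [← ENNReal.tsum_add]
  refine ENNReal.tsum_le_tsum fun e => ?_
  rw [mul_left_comm, ← mul_add]
  gcongr
  have hb : ∀ i, (if i ∈ Set.range e then 1 else u (x i)) +
      θ * (if i ∈ Set.range e then 0 else B.indicator 1 (x i)) =
        if i ∈ Set.range e then 1 else u (x i) + θ * B.indicator 1 (x i) := fun i => by
    split_ifs <;> simp
  have := infProd_add_ge (x := fun i => if i ∈ Set.range e then 1 else u (x i))
    (b := fun i => θ * (if i ∈ Set.range e then 0 else B.indicator 1 (x i))) fun i => by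
      rw [hb]; split_ifs <;> simp [h]
  simp_rw [hb, mul_assoc, ENNReal.tsum_mul_left] at this
  exact this

theorem palmSum_add_le (A : Fin n → Set E) (B : Set E) {θ : ℝ≥0∞}
    (h : ∀ y, u y + θ * B.indicator 1 y ≤ 1) (hfin : {i | x i ∈ B}.Finite) :
    palmSum x A (fun y => u y + θ * B.indicator 1 y) ≤ palmSum x A u +
      θ * palmSum x (Fin.cons B A : Fin (n + 1) → Set E) fun y => u y + θ * B.indicator 1 y := by
  classical
  rw [palmSum_cons, ← ENNReal.tsum_mul_left]
  unfold palmSum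
  rw [← ENNReal.tsum_add]
  refine ENNReal.tsum_le_tsum fun e => ?_
  rw [mul_left_comm, ← mul_add]
  gcongr
  have hb : ∀ i, (if i ∈ Set.range e then 1 else u (x i)) +
      θ * (if i ∈ Set.range e then 0 else B.indicator 1 (x i)) =
        if i ∈ Set.range e then 1 else u (x i) + θ * B.indicator 1 (x i) := fun i => by
    split_ifs <;> simp
  have := infProd_add_le (x := fun i => if i ∈ Set.range e then 1 else u (x i))
    (b := fun i => θ * (if i ∈ Set.range e then 0 else B.indicator 1 (x i))) (fun i => by
      rw [hb]; split_ifs <;> simp [h]) (hfin.subset fun i hi => by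
      by_contra hB
      exact hi (by simp [Set.indicator_of_notMem (show x i ∉ B from hB)]))
  simp_rw [hb, mul_assoc, ENNReal.tsum_mul_left] at this
  exact this

end pointwise

section mean

variable {Ω E : Type*} [MeasurableSpace Ω] [MeasurableSpace E] {μ : Measure Ω}
  {ξ : ℕ → Ω → E} {ν : Measure E}

theorem measurable_restProd (hξ : ∀ i, Measurable (ξ i)) {n : ℕ} (e : Fin n ↪ ℕ)
    {u : E → ℝ≥0∞} (hu : Measurable u) : Measurable fun ω => restProd (fun i => ξ i ω) e u := by
  classical
  refine measurable_infProd (w := fun i ω => if i ∈ Set.range e then 1 else u (ξ i ω)) fun i => ?_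
  split_ifs
  · exact measurable_const
  · exact hu.comp (hξ i)

theorem measurable_palmSum (hξ : ∀ i, Measurable (ξ i)) {n : ℕ} {A : Fin n → Set E}
    (hA : ∀ k, MeasurableSet (A k)) {u : E → ℝ≥0∞} (hu : Measurable u) :
    Measurable fun ω => palmSum (fun i => ξ i ω) A u :=
  Measurable.tsum fun e => (Finset.measurable_fun_prod _ fun k _ =>
    (measurable_one.indicator (hA k)).comp (hξ (e k))).mul (measurable_restProd hξ e hu)

/-- If `c + θ d ≤ c e^{θ b}` for all `θ` near `0`, of either sign, then `d` is the derivative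
`c b` of the right-hand side. -/
theorem eq_mul_of_add_mul_le_mul_exp {b c d θ₀ : ℝ} (hθ₀ : 0 < θ₀)
    (h : ∀ θ, |θ| < θ₀ → c + θ * d ≤ c * Real.exp (θ * b)) : d = c * b := by
  have hmin : IsLocalMin (fun θ : ℝ => c * Real.exp (θ * b) - (c + θ * d)) 0 := by
    filter_upwards [Metric.ball_mem_nhds (0 : ℝ) hθ₀] with θ hθ
    have := h θ (by simpa using hθ)
    simpa using this
  have hder : HasDerivAt (fun θ : ℝ => c * Real.exp (θ * b) - (c + θ * d))
      (c * (Real.exp (0 * b) * (1 * b)) - 1 * d) 0 :=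
    ((((hasDerivAt_id (0 : ℝ)).mul_const b).exp).const_mul c).sub
      (((hasDerivAt_id (0 : ℝ)).mul_const d).const_add c)
  have := hmin.hasDerivAt_eq_zero hder
  simp only [zero_mul, Real.exp_zero, one_mul] at this
  linarith

/-- The value `exp (-∫ (1 - u) dν)` of the Poisson generating functional at `u`. -/
noncomputable def poissonPGFL (ν : Measure E) (u : E → ℝ≥0∞) : ℝ≥0∞ :=
  ENNReal.ofReal (Real.exp (-(∫⁻ x, (1 - u x) ∂ν).toReal))

/-- Perturbing `u` by `θ` on `A` multiplies the generating functional by `exp (θ ν(A))`. -/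
theorem poissonPGFL_add {u : E → ℝ≥0∞} {A : Set E} (hA : MeasurableSet A)
    (hνA : ν A ≠ ∞) {θ : ℝ} (hθ : 0 ≤ θ)
    (h1 : ∀ y, u y + ENNReal.ofReal θ * A.indicator 1 y ≤ 1)
    (hint : ∫⁻ x, (1 - u x) ∂ν ≠ ∞) :
    poissonPGFL ν (fun y => u y + ENNReal.ofReal θ * A.indicator 1 y) =
      ENNReal.ofReal (Real.exp (θ * (ν A).toReal)) * poissonPGFL ν u := by
  have hsplit : ∫⁻ x, (1 - u x) ∂ν =
      ∫⁻ x, (1 - (u x + ENNReal.ofReal θ * A.indicator 1 x)) ∂ν + ENNReal.ofReal θ * ν A := by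
    have hm : Measurable fun x => ENNReal.ofReal θ * A.indicator (1 : E → ℝ≥0∞) x :=
      (measurable_one.indicator hA).const_mul _
    rw [← lintegral_indicator_one hA, ← lintegral_const_mul _ (measurable_one.indicator hA),
      ← lintegral_add_right _ hm]
    refine lintegral_congr fun x => ?_
    rw [← tsub_tsub]
    exact (tsub_add_cancel_of_le (ENNReal.le_sub_of_add_le_left
      ((le_self_add.trans (h1 x)).trans_lt ENNReal.one_lt_top).ne (h1 x))).symm
  have hfin : ∫⁻ x, (1 - (u x + ENNReal.ofReal θ * A.indicator 1 x)) ∂ν ≠ ∞ :=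
    ne_top_of_le_ne_top hint (hsplit ▸ le_self_add)
  unfold poissonPGFL
  rw [← ENNReal.ofReal_mul (Real.exp_pos _).le, ← Real.exp_add, hsplit,
    ENNReal.toReal_add hfin (ENNReal.mul_ne_top ENNReal.ofReal_ne_top hνA), ENNReal.toReal_mul,
    ENNReal.toReal_ofReal hθ]
  congr 2
  ring

/-- The mean of `palmSum`, computed by induction on `n`: the `(n + 1)`-fold sum is the derivative
of the `n`-fold one when `u` is perturbed by `θ` on the additional set. The bounds on `u` over `B`
leave room for perturbations of both signs. -/
theorem HasPoissonPGFL.lintegral_palmSum [IsProbabilityMeasure μ] (h : HasPoissonPGFL μ ξ ν)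
    (hξ : ∀ i, Measurable (ξ i)) {B : Set E} (hνB : ν B ≠ ∞)
    (hfin : ∀ᵐ ω ∂μ, {i | ξ i ω ∈ B}.Finite) {n : ℕ} {A : Fin n → Set E}
    (hA : ∀ k, MeasurableSet (A k)) (hAB : ∀ k, A k ⊆ B) {u : E → ℝ≥0∞} (hu : Measurable u)
    (hu1 : ∀ x, u x ≤ 1) (hint : ∫⁻ x, (1 - u x) ∂ν ≠ ∞) {c : ℝ} (hc : 0 < c)
    (huB : ∀ x ∈ B, ENNReal.ofReal c ≤ u x ∧ u x + ENNReal.ofReal c ≤ 1) :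
    ∫⁻ ω, palmSum (fun i => ξ i ω) A u ∂μ = (∏ k, ν (A k)) * poissonPGFL ν u := by
  induction n generalizing u c with
  | zero =>
    have : ∀ x : ℕ → E, palmSum x A u = infProd fun i => u (x i) := fun x => by
      simp [palmSum, restProd]
    simp_rw [this, h u hu hu1 hint]
    simp [poissonPGFL]
  | succ n ih =>
    obtain ⟨A₀, A, rfl⟩ : ∃ (A₀ : Set E) (A' : Fin n → Set E), A = Fin.cons A₀ A' :=
      ⟨A 0, Fin.tail A, (Fin.cons_self_tail A).symm⟩
    have hA₀ : MeasurableSet A₀ := hA 0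
    have hA' : ∀ k, MeasurableSet (A k) := fun k => hA k.succ
    have hAB₀ : A₀ ⊆ B := hAB 0
    have hAB' : ∀ k, A k ⊆ B := fun k => hAB k.succ
    have hν₀ : ν A₀ ≠ ∞ := ne_top_of_le_ne_top hνB (measure_mono hAB₀)
    have hν : ∀ k, ν (A k) ≠ ∞ := fun k => ne_top_of_le_ne_top hνB (measure_mono (hAB' k))
    obtain ⟨D, hD⟩ : ∃ D : ℝ≥0∞, D =
      ∫⁻ ω, palmSum (fun i => ξ i ω) (Fin.cons A₀ A : Fin (n + 1) → Set E) u ∂μ := ⟨_, rfl⟩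
    have hG : poissonPGFL ν u ≠ ∞ := ENNReal.ofReal_ne_top
    obtain ⟨P, hP⟩ : ∃ P : ℝ≥0∞, P = (∏ k, ν (A k)) * poissonPGFL ν u := ⟨_, rfl⟩
    have hPtop : P ≠ ∞ := hP ▸ ENNReal.mul_ne_top (ENNReal.prod_ne_top fun k _ => hν k) hG
    have hihu := ih hA' hAB' hu hu1 hint hc huB
    rw [← hP] at hihu
    -- an upward perturbation bounds `D` from above
    have hup : ∀ θ : ℝ, 0 ≤ θ → θ < c / 2 →
        P + ENNReal.ofReal θ * D ≤ ENNReal.ofReal (Real.exp (θ * (ν A₀).toReal)) * P := by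
      intro θ hθ hθc
      have h1 : ∀ y, u y + ENNReal.ofReal θ * A₀.indicator 1 y ≤ 1 := fun y => by
        by_cases hy : y ∈ A₀
        · rw [Set.indicator_of_mem hy, Pi.one_apply, mul_one]
          refine le_trans ?_ (huB y (hAB₀ hy)).2
          gcongr
          linarith
        · simpa [Set.indicator_of_notMem hy] using hu1 y
      have hum : Measurable fun y => u y + ENNReal.ofReal θ * A₀.indicator (1 : E → ℝ≥0∞) y :=
        hu.add ((measurable_one.indicator hA₀).const_mul _)
      have hih := ih hA' hAB' hum h1
        (ne_top_of_le_ne_top hint (lintegral_mono fun x => tsub_le_tsub_left le_self_add 1))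
        (c := c / 2) (by linarith) fun x hx => by
          refine ⟨(ENNReal.ofReal_le_ofReal (by linarith)).trans
            ((huB x hx).1.trans le_self_add), ?_⟩
          refine le_trans ?_ (huB x hx).2
          rw [add_assoc]
          gcongr
          calc ENNReal.ofReal θ * A₀.indicator (1 : E → ℝ≥0∞) x + ENNReal.ofReal (c / 2)
              ≤ ENNReal.ofReal θ * 1 + ENNReal.ofReal (c / 2) := by
                gcongr
                exact Set.indicator_le_self' (fun _ _ => zero_le_one) x
            _ = ENNReal.ofReal (θ + c / 2) := by
                rw [mul_one, ENNReal.ofReal_add hθ (by linarith)]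
            _ ≤ ENNReal.ofReal c := ENNReal.ofReal_le_ofReal (by linarith)
      rw [poissonPGFL_add hA₀ hν₀ hθ h1 hint, mul_left_comm, ← hP] at hih
      rw [← hih, hD, ← hihu, ← lintegral_const_mul _ (measurable_palmSum hξ hA hu),
        ← lintegral_add_left (measurable_palmSum hξ hA' hu)]
      exact lintegral_mono fun ω => palmSum_add_ge A A₀ h1
    -- a downward perturbation bounds `D` from below
    have hdown : ∀ θ : ℝ, 0 ≤ θ → θ < c / 2 →
        ENNReal.ofReal (Real.exp (θ * (ν A₀).toReal)) * P ≤
          P + ENNReal.ofReal (Real.exp (θ * (ν A₀).toReal)) * (ENNReal.ofReal θ * D) := by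
      intro θ hθ hθc
      set v : E → ℝ≥0∞ := fun y => u y - ENNReal.ofReal θ * A₀.indicator 1 y with hv
      have hind : ∀ y, ENNReal.ofReal θ * A₀.indicator 1 y ≤ u y := fun y => by
        by_cases hy : y ∈ A₀
        · rw [Set.indicator_of_mem hy, Pi.one_apply, mul_one]
          exact (ENNReal.ofReal_le_ofReal (by linarith)).trans (huB y (hAB₀ hy)).1
        · simp [Set.indicator_of_notMem hy]
      have hvu : (fun y => v y + ENNReal.ofReal θ * A₀.indicator 1 y) = u :=
        funext fun y => tsub_add_cancel_of_le (hind y)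
      have hvm : Measurable v := hu.sub ((measurable_one.indicator hA₀).const_mul _)
      have hv1 : ∀ y, v y ≤ 1 := fun y => tsub_le_self.trans (hu1 y)
      have h1 : ∀ y, v y + ENNReal.ofReal θ * A₀.indicator 1 y ≤ 1 := fun y =>
        (congrFun hvu y).trans_le (hu1 y)
      have hvint : ∫⁻ x, (1 - v x) ∂ν ≠ ∞ := by
        refine ne_top_of_le_ne_top (b := ∫⁻ x, (1 - u x) ∂ν + ENNReal.ofReal θ * ν A₀)
          (ENNReal.add_ne_top.2 ⟨hint, ENNReal.mul_ne_top ENNReal.ofReal_ne_top hν₀⟩) ?_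
        rw [← lintegral_indicator_one hA₀, ← lintegral_const_mul _ (measurable_one.indicator hA₀),
          ← lintegral_add_right _ ((measurable_one.indicator hA₀).const_mul _)]
        refine lintegral_mono fun x => ?_
        rw [tsub_le_iff_right, add_assoc, add_comm (ENNReal.ofReal θ * _),
          show v x + ENNReal.ofReal θ * A₀.indicator 1 x = u x from congrFun hvu x]
        exact le_tsub_add
      have hih := ih hA' hAB' hvm hv1 hvint (c := c / 2) (by linarith) fun x hx => by
        refine ⟨?_, ?_⟩
        · refine ENNReal.le_sub_of_add_le_right
            (ENNReal.mul_ne_top ENNReal.ofReal_ne_top ?_) ?_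
          · exact ((Set.indicator_le_self' (fun _ _ => zero_le_one) x).trans_lt
              ENNReal.one_lt_top).ne
          · calc ENNReal.ofReal (c / 2) + ENNReal.ofReal θ * A₀.indicator (1 : E → ℝ≥0∞) x
                ≤ ENNReal.ofReal (c / 2) + ENNReal.ofReal θ * 1 := by
                  gcongr
                  exact Set.indicator_le_self' (fun _ _ => zero_le_one) x
              _ = ENNReal.ofReal (c / 2 + θ) := by
                  rw [mul_one, ENNReal.ofReal_add (by linarith) hθ]
              _ ≤ ENNReal.ofReal c := ENNReal.ofReal_le_ofReal (by linarith)
              _ ≤ u x := (huB x hx).1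
        · exact (add_le_add tsub_le_self (ENNReal.ofReal_le_ofReal (by linarith))).trans
            (huB x hx).2
      have hadd := poissonPGFL_add hA₀ hν₀ hθ h1 hvint
      rw [hvu] at hadd
      have hle : P ≤ (∏ k, ν (A k)) * poissonPGFL ν v + ENNReal.ofReal θ * D := by
        rw [← hih, hD, ← hihu, ← lintegral_const_mul _ (measurable_palmSum hξ hA hu),
          ← lintegral_add_left (measurable_palmSum hξ hA' hvm)]
        refine lintegral_mono_ae ?_
        filter_upwards [hfin] with ω hω
        have := palmSum_add_le (x := fun i => ξ i ω) A A₀ h1 (hω.subset fun i hi => hAB₀ hi)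
        rwa [hvu] at this
      calc ENNReal.ofReal (Real.exp (θ * (ν A₀).toReal)) * P
          ≤ ENNReal.ofReal (Real.exp (θ * (ν A₀).toReal)) *
              ((∏ k, ν (A k)) * poissonPGFL ν v + ENNReal.ofReal θ * D) := by gcongr
        _ = _ := by rw [mul_add, mul_left_comm, ← hadd, ← hP]
    have hDtop : D ≠ ∞ := fun hDt => by
      have := hup (c / 4) (by linarith) (by linarith)
      rw [hDt, ENNReal.mul_top (by simpa using hc), add_top, top_le_iff] at this
      exact ENNReal.mul_ne_top ENNReal.ofReal_ne_top hPtop this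
    have hreal : D.toReal = P.toReal * (ν A₀).toReal := by
      refine eq_mul_of_add_mul_le_mul_exp (θ₀ := c / 2) (by linarith) fun θ hθ => ?_
      rcases le_total 0 θ with h0 | h0
      · have := ENNReal.toReal_mono (ENNReal.mul_ne_top ENNReal.ofReal_ne_top hPtop)
          (hup θ h0 (by rwa [abs_of_nonneg h0] at hθ))
        rw [ENNReal.toReal_add hPtop (ENNReal.mul_ne_top ENNReal.ofReal_ne_top hDtop),
          ENNReal.toReal_mul, ENNReal.toReal_mul, ENNReal.toReal_ofReal h0,
          ENNReal.toReal_ofReal (Real.exp_pos _).le] at this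
        linarith
      · have hn : (0 : ℝ) ≤ -θ := by linarith
        have hm : ENNReal.ofReal (Real.exp (-θ * (ν A₀).toReal)) * (ENNReal.ofReal (-θ) * D) ≠ ∞ :=
          ENNReal.mul_ne_top ENNReal.ofReal_ne_top (ENNReal.mul_ne_top ENNReal.ofReal_ne_top hDtop)
        have := ENNReal.toReal_mono (ENNReal.add_ne_top.2 ⟨hPtop, hm⟩)
          (hdown (-θ) hn (by rwa [abs_of_nonpos h0] at hθ))
        rw [ENNReal.toReal_add hPtop hm, ENNReal.toReal_mul, ENNReal.toReal_mul,
          ENNReal.toReal_mul, ENNReal.toReal_ofReal hn,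
          ENNReal.toReal_ofReal (Real.exp_pos _).le, neg_mul, Real.exp_neg] at this
        have he := Real.exp_pos (θ * (ν A₀).toReal)
        have h2 := mul_le_mul_of_nonneg_left this he.le
        have h3 : Real.exp (θ * (ν A₀).toReal) * ((Real.exp (θ * (ν A₀).toReal))⁻¹ * P.toReal) =
            P.toReal := by field_simp
        have h4 : Real.exp (θ * (ν A₀).toReal) * (P.toReal +
            (Real.exp (θ * (ν A₀).toReal))⁻¹ * (-θ * D.toReal)) =
            P.toReal * Real.exp (θ * (ν A₀).toReal) - θ * D.toReal := by field_simp; ring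
        rw [h3, h4] at h2
        linarith
    have hprod : (∏ k, ν ((Fin.cons A₀ A : Fin (n + 1) → Set E) k)) * poissonPGFL ν u =
        P * ν A₀ := by
      rw [Fin.prod_univ_succ]
      simp only [Fin.cons_zero, Fin.cons_succ, hP]
      ring
    rw [← hD, hprod, ← ENNReal.toReal_eq_toReal_iff' hDtop (ENNReal.mul_ne_top hPtop hν₀),
      ENNReal.toReal_mul, hreal]

end mean

/-! ### Laplace transforms and finiteness of the shot noise -/

section laplace

/-- A finite measure on the unit interval is determined by its moments. -/
theorem unitInterval_measure_ext_of_moments {P P' : Measure unitInterval} [IsFiniteMeasure P]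
    [IsFiniteMeasure P'] (h : ∀ k : ℕ, ∫ x, (x : ℝ) ^ k ∂P = ∫ x, (x : ℝ) ^ k ∂P') : P = P' := by
  have hint : ∀ (P₀ : Measure unitInterval) [IsFiniteMeasure P₀] (g : C(unitInterval, ℝ)),
      Integrable (fun x => g x) P₀ := fun P₀ _ g =>
    g.continuous.integrable_of_hasCompactSupport (HasCompactSupport.of_compactSpace g)
  have hc : ∀ (P₀ : Measure unitInterval) [IsFiniteMeasure P₀],
      Continuous fun g : C(unitInterval, ℝ) => ∫ x, g x ∂P₀ := fun P₀ _ => by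
    refine (LipschitzWith.of_dist_le_mul (K := (P₀ Set.univ).toNNReal) fun g g' => ?_).continuous
    rw [dist_eq_norm, ← integral_sub (hint P₀ g) (hint P₀ g'), mul_comm, dist_eq_norm]
    exact norm_integral_le_of_norm_le_const (.of_forall fun x => (g - g').norm_coe_le_norm x)
  have hclosed : IsClosed {g : C(unitInterval, ℝ) | ∫ x, g x ∂P = ∫ x, g x ∂P'} :=
    isClosed_eq (hc P) (hc P')
  have hpoly : (polynomialFunctions unitInterval : Set C(unitInterval, ℝ)) ⊆
      {g | ∫ x, g x ∂P = ∫ x, g x ∂P'} := by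
    rw [polynomialFunctions_coe]
    rintro _ ⟨p, rfl⟩
    simp only [Set.mem_ofPred_eq, Polynomial.toContinuousMapOnAlgHom_apply,
      Polynomial.toContinuousMapOn_apply, Polynomial.toContinuousMap_apply]
    have hX : ∀ (P₀ : Measure unitInterval) [IsFiniteMeasure P₀] (k : ℕ) (a : ℝ),
        Integrable (fun x : unitInterval => a * (x : ℝ) ^ k) P₀ := fun P₀ _ k a =>
      hint P₀ ⟨fun x : unitInterval => a * (x : ℝ) ^ k, by fun_prop⟩
    simp_rw [Polynomial.eval_eq_sum_range]
    rw [integral_finsetSum _ fun k _ => hX P k _, integral_finsetSum _ fun k _ => hX P' k _]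
    refine Finset.sum_congr rfl fun k _ => ?_
    rw [integral_const_mul, integral_const_mul, h k]
  refine ext_of_forall_integral_eq_of_IsFiniteMeasure fun f => ?_
  have hf : f.toContinuousMap ∈ (polynomialFunctions unitInterval).topologicalClosure := by
    rw [polynomialFunctions_closure_eq_top']
    trivial
  exact hclosed.closure_subset_iff.2 hpoly hf

/-- Measures on the half-line whose Laplace transforms are finite and agree at the positive
integers are equal: after weighting by `exp (-r)` these are the moments of the image under
`r ↦ exp (-r)`. -/
theorem measure_ext_of_laplace {α β : Measure ℝ} (hα : ∀ᵐ r ∂α, 0 ≤ r) (hβ : ∀ᵐ r ∂β, 0 ≤ r)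
    (hfin : ∫⁻ r, ENNReal.ofReal (Real.exp (-r)) ∂α ≠ ∞)
    (h : ∀ k : ℕ, ∫⁻ r, ENNReal.ofReal (Real.exp (-((k + 1) * r))) ∂α =
      ∫⁻ r, ENNReal.ofReal (Real.exp (-((k + 1) * r))) ∂β) : α = β := by
  set w : ℝ → ℝ≥0∞ := fun r => ENNReal.ofReal (Real.exp (-r)) with hw
  have hwm : Measurable w := by fun_prop
  have hw0 : ∀ r, w r ≠ 0 := fun r => (ENNReal.ofReal_pos.2 (Real.exp_pos _)).ne'
  have hwt : ∀ r, w r ≠ ∞ := fun r => ENNReal.ofReal_ne_top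
  let φ : ℝ → unitInterval := fun r =>
    ⟨Real.exp (-max r 0), (Real.exp_pos _).le, Real.exp_le_one_iff.2 (by simp)⟩
  have hφ : Measurable φ := Measurable.subtype_mk (by fun_prop)
  have hfin' : ∫⁻ r, w r ∂β ≠ ∞ := by
    have := h 0
    simp only [Nat.cast_zero, zero_add, one_mul] at this
    rwa [← this]
  have hαw : IsFiniteMeasure (α.withDensity w) := isFiniteMeasure_withDensity hfin
  have hβw : IsFiniteMeasure (β.withDensity w) := isFiniteMeasure_withDensity hfin'
  have hmom : ∀ (P₀ : Measure ℝ), (∀ᵐ r ∂P₀, 0 ≤ r) → ∀ k : ℕ,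
      ∫ x, (x : ℝ) ^ k ∂((P₀.withDensity w).map φ) =
        (∫⁻ r, ENNReal.ofReal (Real.exp (-((k + 1) * r))) ∂P₀).toReal := fun P₀ hR k => by
    rw [integral_eq_lintegral_of_nonneg_ae
      (Filter.Eventually.of_forall fun x => pow_nonneg x.2.1 k)
      (by fun_prop : Measurable fun x : unitInterval => (x : ℝ) ^ k).aestronglyMeasurable,
      lintegral_map (by fun_prop) hφ, lintegral_withDensity_eq_lintegral_mul _ hwm (by fun_prop)]
    congr 1
    refine lintegral_congr_ae ?_
    filter_upwards [hR] with r hr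
    simp only [Pi.mul_apply, hw, φ, max_eq_left hr]
    rw [← ENNReal.ofReal_mul (Real.exp_pos _).le, ← Real.exp_nat_mul, ← Real.exp_add]
    congr 2
    ring
  have hmap : (α.withDensity w).map φ = (β.withDensity w).map φ := by
    have := (α.withDensity w).isFiniteMeasure_map φ
    have := (β.withDensity w).isFiniteMeasure_map φ
    exact unitInterval_measure_ext_of_moments fun k => by rw [hmom α hα, hmom β hβ, h k]
  have hinv : ∀ (P₀ : Measure ℝ), (∀ᵐ r ∂P₀, 0 ≤ r) →
      ((P₀.withDensity w).map φ).map (fun x : unitInterval => -Real.log x) = P₀.withDensity w := fun P₀ hR => by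
    rw [Measure.map_map (by fun_prop) hφ]
    conv_rhs => rw [← Measure.map_id (μ := P₀.withDensity w)]
    refine Measure.map_congr ?_
    filter_upwards [(withDensity_absolutelyContinuous P₀ w).ae_le hR] with r hr
    simp [φ, max_eq_left (show (0 : ℝ) ≤ r from hr)]
  have hdens : α.withDensity w = β.withDensity w := by rw [← hinv α hα, hmap, hinv β hβ]
  rw [← withDensity_inv_same (μ := α) hwm (.of_forall hw0) (.of_forall hwt), hdens,
    withDensity_inv_same (μ := β) hwm (.of_forall hw0) (.of_forall hwt)]

end laplace

/-- The Laplace weight `exp (-s V)`. -/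
noncomputable def laplaceWeight {E : Type*} (V : E → ℝ≥0) (s : ℝ) (x : E) : ℝ≥0∞ :=
  ENNReal.ofReal (Real.exp (-(s * V x)))

theorem laplaceWeight_le_one {E : Type*} {V : E → ℝ≥0} {s : ℝ} (hs : 0 ≤ s) (x : E) :
    laplaceWeight V s x ≤ 1 :=
  ENNReal.ofReal_le_one.2 (Real.exp_le_one_iff.2 (neg_nonpos.2 (by positivity)))

theorem one_sub_laplaceWeight_le {E : Type*} {V : E → ℝ≥0} (s : ℝ) (x : E) :
    1 - laplaceWeight V s x ≤ ENNReal.ofReal (max 1 s) * min 1 (V x : ℝ≥0∞) := by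
  have h1 : 1 - laplaceWeight V s x = ENNReal.ofReal (1 - Real.exp (-(s * V x))) := by
    rw [laplaceWeight, ENNReal.ofReal_sub _ (Real.exp_pos _).le, ENNReal.ofReal_one]
  have h2 : min 1 (V x : ℝ≥0∞) = ENNReal.ofReal (min 1 (V x : ℝ)) := by
    rw [ENNReal.ofReal_min, ENNReal.ofReal_one, ENNReal.ofReal_coe_nnreal]
  rw [h1, h2, ← ENNReal.ofReal_mul (by positivity)]
  refine ENNReal.ofReal_le_ofReal ?_
  have hV : (0 : ℝ) ≤ V x := (V x).coe_nonneg
  have he := Real.one_sub_le_exp_neg (s * V x)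
  rcases le_total 1 (V x : ℝ) with h | h
  · rw [min_eq_left h, mul_one]
    have := Real.exp_pos (-(s * V x))
    linarith [le_max_left 1 s]
  · rw [min_eq_right h]
    nlinarith [le_max_right 1 s]

section campbell

variable {Ω E : Type*} [MeasurableSpace Ω] [MeasurableSpace E] {μ : Measure Ω}
  {ξ : ℕ → Ω → E} {ν : Measure E} {V : E → ℝ≥0}

theorem measure_le_ne_top_of_lintegral_min (hVm : Measurable V)
    (hV : ∫⁻ x, min 1 (V x : ℝ≥0∞) ∂ν ≠ ∞) {δ : ℝ≥0} (hδ : 0 < δ) :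
    ν {x | δ ≤ V x} ≠ ∞ := by
  have hpos : (min 1 δ : ℝ≥0∞) ≠ 0 := by simpa using hδ.ne'
  refine ne_top_of_le_ne_top (b := (∫⁻ x, min 1 (V x : ℝ≥0∞) ∂ν) / min 1 δ)
    (ENNReal.div_ne_top hV hpos) ?_
  refine (measure_mono fun x hx => ?_).trans
    (meas_ge_le_lintegral_div (by fun_prop) hpos (by simp))
  exact min_le_min le_rfl (ENNReal.coe_le_coe.2 hx)

theorem sigmaFinite_of_lintegral_min (hVm : Measurable V)
    (hV : ∫⁻ x, min 1 (V x : ℝ≥0∞) ∂ν ≠ ∞) (hV0 : ∀ᵐ x ∂ν, V x ≠ 0) : SigmaFinite ν := by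
  refine ⟨⟨⟨fun m : ℕ => {x | V x = 0} ∪ {x | ((m : ℝ≥0) + 1)⁻¹ ≤ V x}, fun _ => trivial,
    fun m => ?_, ?_⟩⟩⟩
  · refine (measure_union_le _ _).trans_lt (ENNReal.add_lt_top.2 ⟨?_, ?_⟩)
    · have : ν {x | V x = 0} = 0 := by simpa [ae_iff] using hV0
      simp [this]
    · exact (measure_le_ne_top_of_lintegral_min hVm hV (by positivity)).lt_top
  · refine Set.eq_univ_of_forall fun x => Set.mem_iUnion.2 ?_
    by_cases h0 : V x = 0
    · exact ⟨0, Or.inl h0⟩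
    · obtain ⟨m, hm⟩ := exists_nat_one_div_lt (pos_iff_ne_zero.2 h0)
      exact ⟨m, Or.inr (by rw [← one_div]; exact hm.le)⟩

theorem infProd_exp_of_summable {a : ℕ → ℝ} (h0 : ∀ i, 0 ≤ a i) (ha : Summable a) :
    infProd (fun i => ENNReal.ofReal (Real.exp (-a i))) =
      ENNReal.ofReal (Real.exp (-∑' i, a i)) := by
  refine tendsto_nhds_unique (tendsto_infProd fun i => ENNReal.ofReal_le_one.2
    (Real.exp_le_one_iff.2 (neg_nonpos.2 (h0 i)))) ?_
  have : ∀ N, ∏ i ∈ Finset.range N, ENNReal.ofReal (Real.exp (-a i)) =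
      ENNReal.ofReal (Real.exp (-∑ i ∈ Finset.range N, a i)) := fun N => by
    rw [← ENNReal.ofReal_prod_of_nonneg fun i _ => (Real.exp_pos _).le, ← Real.exp_sum,
      Finset.sum_neg_distrib]
  simp_rw [this]
  exact ENNReal.tendsto_ofReal ha.hasSum.tendsto_sum_nat.neg.rexp

theorem infProd_exp_of_not_summable {a : ℕ → ℝ} (h0 : ∀ i, 0 ≤ a i) (ha : ¬ Summable a) :
    infProd (fun i => ENNReal.ofReal (Real.exp (-a i))) = 0 := by
  refine tendsto_nhds_unique (tendsto_infProd fun i => ENNReal.ofReal_le_one.2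
    (Real.exp_le_one_iff.2 (neg_nonpos.2 (h0 i)))) ?_
  have : ∀ N, ∏ i ∈ Finset.range N, ENNReal.ofReal (Real.exp (-a i)) =
      ENNReal.ofReal (Real.exp (-∑ i ∈ Finset.range N, a i)) := fun N => by
    rw [← ENNReal.ofReal_prod_of_nonneg fun i _ => (Real.exp_pos _).le, ← Real.exp_sum,
      Finset.sum_neg_distrib]
  simp_rw [this]
  have hlim := (not_summable_iff_tendsto_nat_atTop_of_nonneg h0).1 ha
  simpa using ENNReal.tendsto_ofReal (Real.tendsto_exp_neg_atTop_nhds_zero.comp hlim)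

theorem measurable_laplaceWeight (hVm : Measurable V) (s : ℝ) : Measurable (laplaceWeight V s) := by
  unfold laplaceWeight
  fun_prop

theorem lintegral_one_sub_laplaceWeight_ne_top (hV : ∫⁻ x, min 1 (V x : ℝ≥0∞) ∂ν ≠ ∞) (s : ℝ) :
    ∫⁻ x, (1 - laplaceWeight V s x) ∂ν ≠ ∞ := by
  refine ne_top_of_le_ne_top ?_ (lintegral_mono (one_sub_laplaceWeight_le (V := V) s))
  rw [lintegral_const_mul' _ _ ENNReal.ofReal_ne_top]
  exact ENNReal.mul_ne_top ENNReal.ofReal_ne_top hV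

/-- The shot noise `∑ V (ξ i)` is finite: the probability of this is the limit of its Laplace
transform at `0`. -/
theorem HasPoissonPGFL.ae_summable [IsProbabilityMeasure μ] (h : HasPoissonPGFL μ ξ ν)
    (hξ : ∀ i, Measurable (ξ i)) (hVm : Measurable V)
    (hV : ∫⁻ x, min 1 (V x : ℝ≥0∞) ∂ν ≠ ∞) :
    ∀ᵐ ω ∂μ, Summable fun i => (V (ξ i ω) : ℝ) := by
  have hfun : ∀ ω, (Summable fun i => (V (ξ i ω) : ℝ)) ↔
      ∑' i, (V (ξ i ω) : ℝ≥0∞) ≠ ∞ := fun ω => by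
    rw [NNReal.summable_coe, ENNReal.tsum_coe_ne_top_iff_summable]
  have hmeas : MeasurableSet {ω | Summable fun i => (V (ξ i ω) : ℝ)} := by
    simp_rw [hfun]
    exact (measurableSet_singleton _).compl.preimage
      (Measurable.tsum fun i => (hVm.comp (hξ i)).coe_nnreal_ennreal)
  set s : ℕ → ℝ := fun k => 1 / ((k : ℝ) + 1) with hs
  have hs0 : ∀ k, 0 < s k := fun k => by positivity
  have hs1 : ∀ k, s k ≤ 1 := fun k => by
    rw [hs, div_le_one (by positivity)]
    linarith [(Nat.cast_nonneg k : (0 : ℝ) ≤ k)]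
  have hbound : ∀ k, poissonPGFL ν (laplaceWeight V (s k)) ≤
      μ {ω | Summable fun i => (V (ξ i ω) : ℝ)} := fun k => by
    rw [poissonPGFL, ← h _ (measurable_laplaceWeight hVm _) (laplaceWeight_le_one (hs0 k).le)
      (lintegral_one_sub_laplaceWeight_ne_top hV _), ← lintegral_indicator_one hmeas]
    refine lintegral_mono fun ω => ?_
    by_cases hω : Summable fun i => (V (ξ i ω) : ℝ)
    · rw [Set.indicator_of_mem (show ω ∈ {ω | Summable fun i => (V (ξ i ω) : ℝ)} from hω)]
      exact infProd_le_one _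
    · refine (infProd_exp_of_not_summable (a := fun i => s k * V (ξ i ω))
        (fun i => mul_nonneg (hs0 k).le (V _).coe_nonneg) ?_).trans_le zero_le
      rwa [summable_mul_left_iff (hs0 k).ne']
  have hlim : Filter.Tendsto (fun k => ∫⁻ x, (1 - laplaceWeight V (s k) x) ∂ν) Filter.atTop
      (nhds (∫⁻ _, 0 ∂ν)) := by
    refine tendsto_lintegral_of_dominated_convergence (fun x => min 1 (V x : ℝ≥0∞))
      (fun k => measurable_const.sub (measurable_laplaceWeight hVm _))
      (fun k => .of_forall fun x => ?_) hV (.of_forall fun x => ?_)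
    · simpa [max_eq_left (hs1 k)] using one_sub_laplaceWeight_le (V := V) (s k) x
    · have h0 : Filter.Tendsto s Filter.atTop (nhds 0) := tendsto_one_div_add_atTop_nhds_zero_nat
      have h1 := ENNReal.Tendsto.sub (tendsto_const_nhds (x := (1 : ℝ≥0∞)))
        (ENNReal.tendsto_ofReal (h0.mul_const (V x : ℝ)).neg.rexp) (Or.inl ENNReal.one_ne_top)
      simpa [laplaceWeight] using h1
  have hlim' : Filter.Tendsto (fun k => poissonPGFL ν (laplaceWeight V (s k))) Filter.atTop
      (nhds 1) := by
    have h1 := ENNReal.tendsto_ofReal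
      (((ENNReal.tendsto_toReal (by simp : ∫⁻ _ : E, 0 ∂ν ≠ ∞)).comp hlim).neg.rexp)
    simpa [poissonPGFL] using h1
  have hone : μ {ω | Summable fun i => (V (ξ i ω) : ℝ)} = 1 :=
    le_antisymm prob_le_one (le_of_tendsto' hlim' hbound)
  exact (mem_ae_iff_prob_eq_one hmeas).2 hone

end campbell

/-! ### The Mecke formula -/

section shotNoise

variable {Ω E : Type*} {ξ : ℕ → Ω → E} {V : E → ℝ≥0}

/-- The shot noise `∑ᵢ V (ξ i)`. -/
noncomputable def shotNoise (ξ : ℕ → Ω → E) (V : E → ℝ≥0) (ω : Ω) : ℝ := ∑' i, (V (ξ i ω) : ℝ)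

/-- The `n`-tuple of points with indices `e`, together with the shot noise of all other points. -/
noncomputable def tupleAndRest (ξ : ℕ → Ω → E) (V : E → ℝ≥0) {n : ℕ} (e : Fin n ↪ ℕ) (ω : Ω) :
    (Fin n → E) × ℝ :=
  (fun k => ξ (e k) ω, shotNoise ξ V ω - ∑ k, (V (ξ (e k) ω) : ℝ))

open scoped Classical in
theorem hasSum_ite_range {a : ℕ → ℝ} (ha : Summable a) {n : ℕ} (e : Fin n ↪ ℕ) :
    HasSum (fun i => if i ∈ Set.range e then 0 else a i) (∑' i, a i - ∑ k, a (e k)) := by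
  have h1 : HasSum (fun i => if i ∈ Set.range e then a i else 0) (∑ k, a (e k)) := by
    have := hasSum_sum_of_ne_finset_zero (L := SummationFilter.unconditional ℕ)
      (f := fun i => if i ∈ Set.range e then a i else 0) (s := Finset.univ.map e) fun i hi => if_neg fun ⟨k, hk⟩ =>
        hi (Finset.mem_map.2 ⟨k, Finset.mem_univ _, hk⟩)
    rw [Finset.sum_map] at this
    simpa using this
  have h2 : (fun i => if i ∈ Set.range e then 0 else a i) =
      fun i => a i - if i ∈ Set.range e then a i else 0 := by
    ext i
    split_ifs <;> simp
  rw [h2]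
  exact ha.hasSum.sub h1

theorem rest_nonneg {ω : Ω} (hω : Summable fun i => (V (ξ i ω) : ℝ)) {n : ℕ} (e : Fin n ↪ ℕ) :
    0 ≤ (tupleAndRest ξ V e ω).2 := by
  classical
  refine (hasSum_ite_range hω e).nonneg fun i => ?_
  split_ifs <;> simp

theorem restProd_laplaceWeight {s : ℝ} (hs : 0 ≤ s) {ω : Ω}
    (hω : Summable fun i => (V (ξ i ω) : ℝ)) {n : ℕ} (e : Fin n ↪ ℕ) :
    restProd (fun i => ξ i ω) e (laplaceWeight V s) =
      ENNReal.ofReal (Real.exp (-(s * (tupleAndRest ξ V e ω).2))) := by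
  classical
  have hsum := (hasSum_ite_range hω e).mul_left s
  have h0 : ∀ i, 0 ≤ s * (if i ∈ Set.range e then 0 else (V (ξ i ω) : ℝ)) := fun i => by
    split_ifs <;> positivity
  have := infProd_exp_of_summable h0 hsum.summable
  rw [hsum.tsum_eq] at this
  rw [tupleAndRest, shotNoise, ← this, restProd]
  congr 1
  ext i
  split_ifs <;> simp [laplaceWeight]

/-- The sets on which `V` lies between `1 / (m + 1)` and `m + 1`. -/
def levelBand (V : E → ℝ≥0) (m : ℕ) : Set E := {x | ((m : ℝ≥0) + 1)⁻¹ ≤ V x ∧ V x ≤ m + 1}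

theorem monotone_levelBand : Monotone (levelBand V) := fun m l hml x hx => by
  have h : (m : ℝ≥0) + 1 ≤ l + 1 := by gcongr
  exact ⟨(inv_anti₀ (by positivity) h).trans hx.1, hx.2.trans h⟩

theorem iUnion_levelBand : ⋃ m, levelBand V m = {x | V x ≠ 0} := by
  ext x
  simp only [Set.mem_iUnion, Set.mem_ofPred_eq]
  constructor
  · rintro ⟨m, hm, -⟩ h0
    rw [h0] at hm
    exact absurd hm (not_le.2 (by positivity))
  · intro h0
    obtain ⟨m, hm⟩ := exists_nat_one_div_lt (pos_iff_ne_zero.2 h0)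
    obtain ⟨l, hl⟩ := exists_nat_ge (V x)
    have h1 : x ∈ {x | ((m : ℝ≥0) + 1)⁻¹ ≤ V x} := by
      rw [← one_div]; exact hm.le
    refine ⟨max m l, ?_, ?_⟩
    · refine le_trans (inv_anti₀ (by positivity) ?_) h1
      gcongr
      exact le_max_left m l
    · refine hl.trans ?_
      refine le_trans ?_ (le_add_of_nonneg_right zero_le_one)
      exact_mod_cast le_max_right m l

/-- On a level band the Laplace weight stays away from `0` and `1`. -/
theorem laplaceWeight_levelBand {s : ℝ} (hs : 0 < s) (m : ℕ) :
    ∃ c : ℝ, 0 < c ∧ ∀ x ∈ levelBand V m, ENNReal.ofReal c ≤ laplaceWeight V s x ∧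
      laplaceWeight V s x + ENNReal.ofReal c ≤ 1 := by
  set a : ℝ := Real.exp (-(s * (m + 1)))
  set b : ℝ := Real.exp (-(s * ((m : ℝ) + 1)⁻¹)) with hb
  have hb1 : b < 1 := Real.exp_lt_one_iff.2 (neg_lt_zero.2 (by positivity))
  refine ⟨min a (1 - b), lt_min (Real.exp_pos _) (by linarith), fun x hx => ⟨?_, ?_⟩⟩
  · refine ENNReal.ofReal_le_ofReal ((min_le_left _ _).trans (Real.exp_le_exp.2 ?_))
    have : (V x : ℝ) ≤ m + 1 := by exact_mod_cast hx.2
    gcongr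
  · rw [laplaceWeight, ← ENNReal.ofReal_add (Real.exp_pos _).le
      (le_min (Real.exp_pos _).le (by linarith)), ENNReal.ofReal_le_one]
    have h1 : ((m : ℝ) + 1)⁻¹ ≤ V x := by exact_mod_cast hx.1
    have h2 : Real.exp (-(s * V x)) ≤ b := by
      rw [hb]
      gcongr
    linarith [min_le_right a (1 - b)]

theorem finite_setOf_le_of_summable {a : ℕ → ℝ≥0} (ha : Summable fun i => (a i : ℝ)) {δ : ℝ≥0}
    (hδ : 0 < δ) : {i | δ ≤ a i}.Finite := by
  have h := (NNReal.tendsto_cofinite_zero_of_summable (NNReal.summable_coe.1 ha)).eventually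
    (Iio_mem_nhds hδ)
  rw [Filter.eventually_cofinite] at h
  exact h.subset fun i hi => not_lt.2 hi

end shotNoise

section mecke

variable {Ω E : Type*} [MeasurableSpace Ω] [MeasurableSpace E] {μ : Measure Ω}
  {ξ : ℕ → Ω → E} {ν : Measure E} {V : E → ℝ≥0}

/-- The reduced Campbell measure of order `n`, with the remaining points recorded only through
their shot noise. -/
noncomputable def reducedCampbell (μ : Measure Ω) (ξ : ℕ → Ω → E) (V : E → ℝ≥0) (n : ℕ) :
    Measure ((Fin n → E) × ℝ) :=
  Measure.sum fun e : Fin n ↪ ℕ => μ.map (tupleAndRest ξ V e)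

theorem measurable_shotNoise (hξ : ∀ i, Measurable (ξ i)) (hVm : Measurable V) :
    Measurable (shotNoise ξ V) :=
  Measurable.tsum fun i => (hVm.comp (hξ i)).coe_nnreal_real

theorem measurable_tupleAndRest (hξ : ∀ i, Measurable (ξ i)) (hVm : Measurable V) {n : ℕ}
    (e : Fin n ↪ ℕ) : Measurable (tupleAndRest ξ V e) :=
  (measurable_pi_lambda _ fun k => hξ (e k)).prodMk
    ((measurable_shotNoise hξ hVm).sub
      (Finset.measurable_fun_sum _ fun k _ => (hVm.comp (hξ (e k))).coe_nnreal_real))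

theorem lintegral_reducedCampbell (hξ : ∀ i, Measurable (ξ i)) (hVm : Measurable V) {n : ℕ}
    {g : (Fin n → E) × ℝ → ℝ≥0∞} (hg : Measurable g) :
    ∫⁻ p, g p ∂(reducedCampbell μ ξ V n) = ∑' e, ∫⁻ ω, g (tupleAndRest ξ V e ω) ∂μ := by
  rw [reducedCampbell, lintegral_sum_measure]
  exact tsum_congr fun e => lintegral_map hg (measurable_tupleAndRest hξ hVm e)

theorem measurableSet_levelBand (hVm : Measurable V) (m : ℕ) : MeasurableSet (levelBand V m) :=
  measurableSet_Icc.preimage hVm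

/-- The Mecke formula on rectangles contained in a level band: both sides, as measures in the
shot-noise coordinate, have the same Laplace transform. -/
theorem HasPoissonPGFL.reducedCampbell_rectangle [IsProbabilityMeasure μ]
    (h : HasPoissonPGFL μ ξ ν) (hξ : ∀ i, Measurable (ξ i)) (hVm : Measurable V)
    (hV : ∫⁻ x, min 1 (V x : ℝ≥0∞) ∂ν ≠ ∞) {n m : ℕ} {A : Fin n → Set E}
    (hA : ∀ k, MeasurableSet (A k)) (hAm : ∀ k, A k ⊆ levelBand V m) {C : Set ℝ}
    (hC : MeasurableSet C) :
    reducedCampbell μ ξ V n (Set.univ.pi A ×ˢ C) =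
      (∏ k, ν (A k)) * μ.map (shotNoise ξ V) C := by
  have hsumm := h.ae_summable hξ hVm hV
  have hνm : ν (levelBand V m) ≠ ∞ :=
    ne_top_of_le_ne_top (measure_le_ne_top_of_lintegral_min hVm hV (δ := ((m : ℝ≥0) + 1)⁻¹)
      (by positivity)) (measure_mono fun x hx => hx.1)
  have hfin : ∀ᵐ ω ∂μ, {i | ξ i ω ∈ levelBand V m}.Finite := by
    filter_upwards [hsumm] with ω hω
    exact (finite_setOf_le_of_summable hω (δ := ((m : ℝ≥0) + 1)⁻¹) (by positivity)).subset
      fun i hi => hi.1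
  have hpi : MeasurableSet (Set.univ.pi A) := MeasurableSet.univ_pi hA
  set c : ℝ≥0∞ := ∏ k, ν (A k) with hc
  have hctop : c ≠ ∞ := ENNReal.prod_ne_top fun k _ =>
    ne_top_of_le_ne_top hνm (measure_mono (hAm k))
  set α : Measure ℝ :=
    ((reducedCampbell μ ξ V n).restrict (Prod.fst ⁻¹' Set.univ.pi A)).map Prod.snd with hα
  set β : Measure ℝ := c • μ.map (shotNoise ξ V) with hβ
  have hIm := measurable_shotNoise hξ hVm
  have hfst : MeasurableSet (Prod.fst ⁻¹' Set.univ.pi A : Set ((Fin n → E) × ℝ)) :=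
    measurable_fst hpi
  have hlapα : ∀ s : ℝ, 0 < s → ∫⁻ r, ENNReal.ofReal (Real.exp (-(s * r))) ∂α =
      c * poissonPGFL ν (laplaceWeight V s) := fun s hs => by
    obtain ⟨δ, hδ, hband⟩ := laplaceWeight_levelBand (V := V) hs m
    rw [hc, ← h.lintegral_palmSum hξ hνm hfin hA hAm (measurable_laplaceWeight hVm s)
      (laplaceWeight_le_one hs.le) (lintegral_one_sub_laplaceWeight_ne_top hV s) hδ hband, hα,
      lintegral_map (by fun_prop) measurable_snd, ← lintegral_indicator hfst,
      lintegral_reducedCampbell hξ hVm (Measurable.indicator (by fun_prop) hfst)]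
    unfold palmSum
    have hterm : ∀ e : Fin n ↪ ℕ, Measurable fun ω =>
        (∏ k, (A k).indicator (1 : E → ℝ≥0∞) (ξ (e k) ω)) *
          restProd (fun i => ξ i ω) e (laplaceWeight V s) := fun e =>
      (Finset.measurable_fun_prod _ fun k _ =>
        (measurable_one.indicator (hA k)).comp (hξ (e k))).mul
          (measurable_restProd hξ e (measurable_laplaceWeight hVm s))
    rw [lintegral_tsum fun e => (hterm e).aemeasurable]
    refine tsum_congr fun e => lintegral_congr_ae ?_
    filter_upwards [hsumm] with ω hω
    rw [restProd_laplaceWeight hs.le hω]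
    by_cases hmem : ∀ k, ξ (e k) ω ∈ A k
    · rw [Set.indicator_of_mem (by simpa [tupleAndRest] using hmem),
        Finset.prod_eq_one fun k _ => Set.indicator_of_mem (hmem k) _, one_mul]
    · rw [Set.indicator_of_notMem (by simpa [tupleAndRest] using hmem)]
      obtain ⟨k, hk⟩ := not_forall.1 hmem
      rw [Finset.prod_eq_zero (Finset.mem_univ k) (Set.indicator_of_notMem hk _), zero_mul]
  have hlapβ : ∀ s : ℝ, 0 < s → ∫⁻ r, ENNReal.ofReal (Real.exp (-(s * r))) ∂β =
      c * poissonPGFL ν (laplaceWeight V s) := fun s hs => by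
    rw [hβ, lintegral_smul_measure, lintegral_map (by fun_prop) hIm, smul_eq_mul, poissonPGFL,
      ← h _ (measurable_laplaceWeight hVm s) (laplaceWeight_le_one hs.le)
        (lintegral_one_sub_laplaceWeight_ne_top hV s)]
    congr 1
    refine lintegral_congr_ae ?_
    filter_upwards [hsumm] with ω hω
    have := infProd_exp_of_summable (a := fun i => s * V (ξ i ω)) (fun i => by positivity)
      (hω.mul_left s)
    rw [tsum_mul_left] at this
    exact this.symm
  have hpos : MeasurableSet {r : ℝ | 0 ≤ r} := measurableSet_Ici
  have hsnd : MeasurableSet {p : (Fin n → E) × ℝ | 0 ≤ p.2} := measurable_snd hpos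
  have hα0 : ∀ᵐ r ∂α, 0 ≤ r := by
    rw [hα, ae_map_iff measurable_snd.aemeasurable hpos]
    refine ae_restrict_of_ae ?_
    rw [reducedCampbell, Measure.ae_sum_iff' hsnd]
    intro e
    rw [ae_map_iff (measurable_tupleAndRest hξ hVm e).aemeasurable hsnd]
    filter_upwards [hsumm] with ω hω
    exact rest_nonneg hω e
  have hβ0 : ∀ᵐ r ∂β, 0 ≤ r := by
    refine Measure.ae_smul_measure ?_ c
    rw [ae_map_iff hIm.aemeasurable hpos]
    exact .of_forall fun ω => tsum_nonneg fun i => (V _).coe_nonneg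
  have hαβ : α = β := by
    refine measure_ext_of_laplace hα0 hβ0 ?_ fun k => ?_
    · have := hlapα 1 one_pos
      simp only [one_mul] at this
      rw [this]
      exact ENNReal.mul_ne_top hctop ENNReal.ofReal_ne_top
    · rw [hlapα _ (by positivity), hlapβ _ (by positivity)]
  have hfinal := congrArg (fun M : Measure ℝ => M C) hαβ
  simp only [hα, hβ, Measure.smul_apply, smul_eq_mul] at hfinal
  rw [← hfinal, Measure.map_apply measurable_snd hC, Measure.restrict_apply (measurable_snd hC)]
  congr 1
  ext p
  simp [and_comm]

/-- A rectangle is exhausted by its parts in the level bands, up to points with `V = 0`. -/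
theorem measure_rectangle_eq_iSup {n : ℕ} {M : Measure ((Fin n → E) × ℝ)}
    (hM : ∀ᵐ p ∂M, ∀ k, V (p.1 k) ≠ 0) (A : Fin n → Set E) (C : Set ℝ) :
    M (Set.univ.pi A ×ˢ C) = ⨆ m, M (Set.univ.pi (fun k => A k ∩ levelBand V m) ×ˢ C) := by
  have hmono : Monotone fun m => Set.univ.pi (fun k => A k ∩ levelBand V m) ×ˢ C :=
    fun m l hml => Set.prod_mono_left
      (Set.pi_mono fun k _ => Set.inter_subset_inter_right _ (monotone_levelBand hml))
  rw [← hmono.measure_iUnion]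
  refine measure_congr ?_
  filter_upwards [hM] with p hp
  refine propext ⟨fun hmem => ?_, fun hmem => ?_⟩
  · have hk : ∀ k, ∃ m, p.1 k ∈ levelBand V m := fun k => by
      have : p.1 k ∈ ⋃ m, levelBand V m := iUnion_levelBand ▸ hp k
      exact Set.mem_iUnion.1 this
    choose f hf using hk
    refine Set.mem_iUnion.2 ⟨Finset.univ.sup f, fun k hk => ⟨hmem.1 k hk, ?_⟩, hmem.2⟩
    exact monotone_levelBand (Finset.le_sup (Finset.mem_univ k)) (hf k)
  · obtain ⟨m, hm⟩ := Set.mem_iUnion.1 hmem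
    exact ⟨fun k hk => (hm.1 k hk).1, hm.2⟩

/-- The Mecke formula: picking `n` distinct points of the process, the shot noise of the other
points is independent of the picked ones and distributed as the full shot noise. -/
theorem HasPoissonPGFL.reducedCampbell_eq [IsProbabilityMeasure μ] [SigmaFinite ν]
    (h : HasPoissonPGFL μ ξ ν) (hξ : ∀ i, Measurable (ξ i)) (hVm : Measurable V)
    (hV : ∫⁻ x, min 1 (V x : ℝ≥0∞) ∂ν ≠ ∞) (hV0 : ∀ᵐ x ∂ν, V x ≠ 0)
    (hξ0 : ∀ᵐ ω ∂μ, ∀ i, V (ξ i ω) ≠ 0) (n : ℕ) :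
    reducedCampbell μ ξ V n = (Measure.pi fun _ => ν).prod (μ.map (shotNoise ξ V)) := by
  have hIm := measurable_shotNoise hξ hVm
  have := Measure.isProbabilityMeasure_map (μ := μ) hIm.aemeasurable
  have hset : MeasurableSet {p : (Fin n → E) × ℝ | ∀ k, V (p.1 k) ≠ 0} := by
    rw [Set.ofPred_forall]
    exact MeasurableSet.iInter fun k =>
      (measurableSet_singleton (0 : ℝ≥0)).compl.preimage (by fun_prop)
  have h1 : ∀ᵐ p ∂(reducedCampbell μ ξ V n), ∀ k, V (p.1 k) ≠ 0 := by
    rw [reducedCampbell, Measure.ae_sum_iff' hset]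
    intro e
    rw [ae_map_iff (measurable_tupleAndRest hξ hVm e).aemeasurable hset]
    filter_upwards [hξ0] with ω hω k
    exact hω _
  have h2 : ∀ᵐ p ∂((Measure.pi fun _ : Fin n => ν).prod (μ.map (shotNoise ξ V))),
      ∀ k, V (p.1 k) ≠ 0 := by
    have : ∀ᵐ x ∂(Measure.pi fun _ : Fin n => ν), ∀ k, V (x k) ≠ 0 :=
      ae_all_iff.2 fun k =>
      (Measure.quasiMeasurePreserving_eval (fun _ : Fin n => ν) k).ae hV0
    exact Measure.quasiMeasurePreserving_fst.ae this
  have hrect : ∀ (A : Fin n → Set E) (C : Set ℝ), (∀ k, MeasurableSet (A k)) → MeasurableSet C →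
      reducedCampbell μ ξ V n (Set.univ.pi A ×ˢ C) =
        Measure.pi (fun _ => ν) (Set.univ.pi A) * μ.map (shotNoise ξ V) C := by
    intro A C hA hC
    rw [← Measure.prod_prod, measure_rectangle_eq_iSup h1, measure_rectangle_eq_iSup h2]
    refine iSup_congr fun m => ?_
    rw [h.reducedCampbell_rectangle hξ hVm hV
      (fun k => (hA k).inter (measurableSet_levelBand hVm m)) (fun k => Set.inter_subset_right) hC,
      Measure.prod_prod, Measure.pi_pi]
  refine (Measure.prod_eq_generateFrom (generateFrom_pi (ι := Fin n) (α := fun _ => E))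
    MeasurableSpace.generateFrom_measurableSet isPiSystem_pi
    MeasurableSpace.isPiSystem_measurableSet
    (Measure.FiniteSpanningSetsIn.pi fun _ => ν.toFiniteSpanningSetsIn)
    (μ.map (shotNoise ξ V)).toFiniteSpanningSetsIn ?_).symm
  rintro _ ⟨A, hA, rfl⟩ C hC
  exact hrect A C (fun k => hA k (Set.mem_univ k)) hC

end mecke

/-! ### The intensity of received powers and thresholds -/

namespace HetNetwork

variable {Ω : Type*} [MeasurableSpace Ω] {μ : Measure Ω}

/-- The gain of the path from `x`: the power received from a station at `x` with `P S = 1`. -/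
noncomputable def pathGain (N : HetNetwork μ) (x : EuclideanSpace ℝ (Fin 2)) : ℝ≥0 :=
  (((N.K * ‖x‖) ^ N.β)⁻¹).toNNReal

/-- The received power and the threshold of a station at `p.1` with mark `p.2 = (S, P, T)`. -/
noncomputable def received (N : HetNetwork μ)
    (p : EuclideanSpace ℝ (Fin 2) × ℝ × ℝ × ℝ) : ℝ≥0 × ℝ :=
  ((((N.K * ‖p.1‖) ^ N.β / (p.2.2.1 * p.2.1))⁻¹).toNNReal, p.2.2.2)

/-- The received power and the threshold of station `i`. -/
noncomputable def powerThreshold (N : HetNetwork μ) (i : ℕ) (ω : Ω) : ℝ≥0 × ℝ :=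
  (((N.loss i ω)⁻¹).toNNReal, N.T i ω)

/-- The intensity of the received powers. -/
noncomputable def powerIntensity (N : HetNetwork μ) : Measure ℝ≥0 :=
  N.moment • (ENNReal.ofReal N.dens • volume : Measure (EuclideanSpace ℝ (Fin 2))).map N.pathGain

variable (N : HetNetwork μ)

theorem measurable_pathGain : Measurable N.pathGain := by
  unfold pathGain
  fun_prop

theorem measurable_received : Measurable N.received := by
  unfold received
  fun_prop

theorem measurable_weight : Measurable N.weight := by
  unfold weight
  fun_prop

theorem measurable_powerThreshold (i : ℕ) : Measurable (N.powerThreshold i) :=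
  ((N.measurable_loss i).inv.real_toNNReal).prodMk (N.measurable_T i)

theorem isProbabilityMeasure_markLaw [IsProbabilityMeasure μ] :
    IsProbabilityMeasure N.markLaw := by
  rw [← (N.marks_law 0).map_eq]
  exact Measure.isProbabilityMeasure_map (N.marks_law 0).aemeasurable

theorem moment_ne_zero [IsProbabilityMeasure μ] : N.moment ≠ 0 := by
  have := N.isProbabilityMeasure_markLaw
  intro h
  rw [moment, lintegral_eq_zero_iff N.measurable_weight] at h
  obtain ⟨m, hm, h1, h2, -⟩ := (h.and N.marks_pos).exists
  exact (ENNReal.ofReal_pos.2 (Real.rpow_pos_of_pos (mul_pos h2 h1) _)).ne' hm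

theorem thresholdLaw_apply {C : Set ℝ} (hC : MeasurableSet C) :
    N.thresholdLaw C = N.moment⁻¹ * ∫⁻ m, C.indicator 1 m.2.2 * N.weight m ∂N.markLaw := by
  have hs : MeasurableSet {m : ℝ × ℝ × ℝ | m.2.2 ∈ C} := hC.preimage (by fun_prop)
  rw [thresholdLaw, Measure.smul_apply, Measure.map_apply (by fun_prop) hC, smul_eq_mul]
  congr 1
  change (N.markLaw.withDensity N.weight) {m | m.2.2 ∈ C} = _
  rw [withDensity_apply _ hs, ← lintegral_indicator hs]
  refine lintegral_congr fun m => ?_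
  by_cases hm : m.2.2 ∈ C
  · rw [Set.indicator_of_mem hm, Set.indicator_of_mem (show m ∈ {m : ℝ × ℝ × ℝ | m.2.2 ∈ C} from hm),
      Pi.one_apply, one_mul]
  · rw [Set.indicator_of_notMem hm,
      Set.indicator_of_notMem (show m ∉ {m : ℝ × ℝ × ℝ | m.2.2 ∈ C} from hm), zero_mul]

theorem isProbabilityMeasure_thresholdLaw [IsProbabilityMeasure μ] (hmoment : N.moment < ∞) :
    IsProbabilityMeasure N.thresholdLaw := by
  refine ⟨?_⟩
  rw [N.thresholdLaw_apply MeasurableSet.univ]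
  simp only [Set.indicator_univ, Pi.one_apply, one_mul]
  exact ENNReal.inv_mul_cancel N.moment_ne_zero hmoment.ne

theorem thresholdLaw_Iic_zero : N.thresholdLaw (Set.Iic 0) = 0 := by
  rw [N.thresholdLaw_apply measurableSet_Iic]
  refine mul_eq_zero_of_right _ ?_
  rw [lintegral_congr_ae (g := fun _ => 0)]
  · simp
  · filter_upwards [N.marks_pos] with m hm
    rw [Set.indicator_of_notMem (by simpa using hm.2.2), zero_mul]

/-- Multiplying the received power by `κ` amounts to rescaling the plane by `κ ^ (-1 / β)`, which
multiplies areas by `κ ^ (2 / β)`. -/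
theorem volume_scaled_pathGain {κ : ℝ} (hκ : 0 < κ) (s : Set ℝ≥0) :
    volume {x : EuclideanSpace ℝ (Fin 2) | (((N.K * ‖x‖) ^ N.β / κ)⁻¹).toNNReal ∈ s} =
      ENNReal.ofReal (κ ^ (2 / N.β)) * volume (N.pathGain ⁻¹' s) := by
  have hβ : 0 < N.β := by linarith [N.two_lt_β]
  set r : ℝ := κ ^ (-1 / N.β) with hr
  have hr0 : 0 < r := Real.rpow_pos_of_pos hκ _
  have hset : {x : EuclideanSpace ℝ (Fin 2) | (((N.K * ‖x‖) ^ N.β / κ)⁻¹).toNNReal ∈ s} =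
      (r • ·) ⁻¹' (N.pathGain ⁻¹' s) := by
    ext x
    simp only [Set.mem_ofPred_eq, Set.mem_preimage, pathGain]
    have h1 : (N.K * ‖r • x‖) ^ N.β = (N.K * ‖x‖) ^ N.β / κ := by
      rw [norm_smul, Real.norm_of_nonneg hr0.le, mul_left_comm,
        Real.mul_rpow hr0.le (mul_nonneg N.K_pos.le (norm_nonneg _)), hr, ← Real.rpow_mul hκ.le,
        div_mul_cancel₀ _ hβ.ne', Real.rpow_neg_one, inv_mul_eq_div]
    rw [h1]
  rw [hset, Measure.addHaar_preimage_smul _ hr0.ne', finrank_euclideanSpace_fin]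
  congr 2
  rw [abs_of_pos (by positivity), hr, ← Real.rpow_natCast, ← Real.rpow_mul hκ.le,
    ← Real.rpow_neg hκ.le]
  congr 1
  push_cast
  ring

/-- The path gain decays like `‖x‖ ^ (-β)`, which is integrable at infinity in the plane because
`β > 2`; truncation at `1` removes the singularity at the origin. -/
theorem lintegral_min_pathGain_ne_top :
    ∫⁻ x, min 1 (N.pathGain x : ℝ≥0∞) ∂(volume : Measure (EuclideanSpace ℝ (Fin 2))) ≠ ∞ := by
  have hβ : 0 < N.β := by linarith [N.two_lt_β]
  have hint := integrable_one_add_norm (E := EuclideanSpace ℝ (Fin 2)) (μ := volume) (r := N.β)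
    (by simpa using N.two_lt_β)
  set M : ℝ := 2 * max 1 N.K⁻¹ with hM
  have hM0 : 0 < M := by positivity
  refine ne_top_of_le_ne_top ((hint.const_mul (M ^ N.β)).lintegral_lt_top).ne
    (lintegral_mono fun x => ?_)
  have hx : 0 ≤ ‖x‖ := norm_nonneg x
  set y : ℝ := N.K * ‖x‖ with hy
  have hy0 : 0 ≤ y := mul_nonneg N.K_pos.le hx
  have h1 : min 1 (N.pathGain x : ℝ≥0∞) = ENNReal.ofReal (min 1 (y ^ N.β)⁻¹) := by
    rw [ENNReal.ofReal_min, ENNReal.ofReal_one]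
    rfl
  rw [h1]
  refine ENNReal.ofReal_le_ofReal ?_
  have h2 : 1 + ‖x‖ ≤ M * max 1 y := by
    have h3 : ‖x‖ = N.K⁻¹ * y := by rw [hy, inv_mul_cancel_left₀ N.K_pos.ne']
    have h4 : (1 : ℝ) ≤ max 1 N.K⁻¹ * max 1 y := by
      nlinarith [le_max_left 1 N.K⁻¹, le_max_left 1 y]
    have h5 : N.K⁻¹ * y ≤ max 1 N.K⁻¹ * max 1 y :=
      mul_le_mul (le_max_right _ _) (le_max_right _ _) hy0 (by positivity)
    rw [h3, hM]
    linarith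
  have h6 : min 1 (y ^ N.β)⁻¹ ≤ (max 1 y) ^ (-N.β) := by
    rcases le_total y 1 with h | h
    · rw [max_eq_left h, Real.one_rpow]
      exact min_le_left _ _
    · rw [max_eq_right h, Real.rpow_neg hy0]
      exact min_le_right _ _
  refine h6.trans ?_
  have hmax : 0 < max 1 y := by positivity
  have h7 : (M * max 1 y) ^ (-N.β) ≤ (1 + ‖x‖) ^ (-N.β) :=
    Real.rpow_le_rpow_of_nonpos (by positivity) h2 (by linarith)
  calc (max 1 y) ^ (-N.β) = M ^ N.β * (M * max 1 y) ^ (-N.β) := by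
        rw [Real.mul_rpow hM0.le hmax.le, ← mul_assoc, ← Real.rpow_add hM0, add_neg_cancel,
          Real.rpow_zero, one_mul]
    _ ≤ _ := by gcongr

theorem lintegral_min_powerIntensity_ne_top (hmoment : N.moment < ∞) :
    ∫⁻ v, min 1 (v : ℝ≥0∞) ∂N.powerIntensity ≠ ∞ := by
  rw [powerIntensity, lintegral_smul_measure, lintegral_map (by fun_prop) N.measurable_pathGain,
    lintegral_smul_measure]
  exact ENNReal.mul_ne_top hmoment.ne (ENNReal.mul_ne_top ENNReal.ofReal_ne_top
    N.lintegral_min_pathGain_ne_top)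

/-- The intensity of the received powers has no atoms, because spheres are Lebesgue null. -/
theorem powerIntensity_singleton (c : ℝ≥0) : N.powerIntensity {c} = 0 := by
  have hβ : 0 < N.β := by linarith [N.two_lt_β]
  rw [powerIntensity, Measure.smul_apply, Measure.map_apply N.measurable_pathGain
    (measurableSet_singleton c), Measure.smul_apply]
  have hsub : N.pathGain ⁻¹' {c} ⊆
      Metric.sphere (0 : EuclideanSpace ℝ (Fin 2)) (((c : ℝ)⁻¹) ^ N.β⁻¹ / N.K) := by
    intro x hx
    have hy : 0 ≤ N.K * ‖x‖ := mul_nonneg N.K_pos.le (norm_nonneg x)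
    have hc : ((N.K * ‖x‖) ^ N.β)⁻¹ = c := by
      have : (((N.K * ‖x‖) ^ N.β)⁻¹).toNNReal = c := hx
      rw [← this, Real.coe_toNNReal _ (inv_nonneg.2 (Real.rpow_nonneg hy _))]
    rw [mem_sphere_zero_iff_norm, ← hc, inv_inv, Real.rpow_rpow_inv hy hβ.ne',
      mul_div_cancel_left₀ _ N.K_pos.ne']
  rw [measure_mono_null hsub (Measure.addHaar_sphere _ _ _), smul_zero, smul_zero]

theorem ae_powerIntensity_ne_zero : ∀ᵐ v ∂N.powerIntensity, v ≠ 0 := by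
  rw [ae_iff]
  simpa using N.powerIntensity_singleton 0

theorem sigmaFinite_powerIntensity (hmoment : N.moment < ∞) : SigmaFinite N.powerIntensity :=
  sigmaFinite_of_lintegral_min (V := fun v => v)
    measurable_id (N.lintegral_min_powerIntensity_ne_top hmoment) N.ae_powerIntensity_ne_zero

/-- Under the intensity of the marked process, the received power and the threshold are
independent, and the threshold has the law of `T*`. -/
theorem map_received [IsProbabilityMeasure μ] (hmoment : N.moment < ∞) :
    ((ENNReal.ofReal N.dens • volume : Measure (EuclideanSpace ℝ (Fin 2))).prod
      N.markLaw).map N.received = N.powerIntensity.prod N.thresholdLaw := by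
  have := N.isProbabilityMeasure_markLaw
  have := N.isProbabilityMeasure_thresholdLaw hmoment
  have := N.sigmaFinite_powerIntensity hmoment
  refine (Measure.prod_eq fun s C hs hC => ?_).symm
  have hw : Measurable fun m : ℝ × ℝ × ℝ => C.indicator (1 : ℝ → ℝ≥0∞) m.2.2 * N.weight m :=
    ((measurable_one.indicator hC).comp (by fun_prop)).mul N.measurable_weight
  have hsC : MeasurableSet (N.received ⁻¹' (s ×ˢ C)) := N.measurable_received (hs.prod hC)
  rw [Measure.map_apply N.measurable_received (hs.prod hC), Measure.prod_apply_symm hsC,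
    N.thresholdLaw_apply hC, powerIntensity, Measure.smul_apply, smul_eq_mul,
    Measure.map_apply N.measurable_pathGain hs, Measure.smul_apply, smul_eq_mul,
    mul_mul_mul_comm, ENNReal.mul_inv_cancel N.moment_ne_zero hmoment.ne, one_mul,
    ← lintegral_const_mul _ hw]
  refine lintegral_congr_ae ?_
  filter_upwards [N.marks_pos] with m hm
  by_cases hmC : m.2.2 ∈ C
  · have : (fun x => (x, m)) ⁻¹' (N.received ⁻¹' (s ×ˢ C)) =
        {x | (((N.K * ‖x‖) ^ N.β / (m.2.1 * m.1))⁻¹).toNNReal ∈ s} := by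
      ext x
      simp [received, hmC]
    rw [this, Measure.smul_apply, smul_eq_mul,
      N.volume_scaled_pathGain (mul_pos hm.2.1 hm.1), Set.indicator_of_mem hmC, Pi.one_apply,
      one_mul, weight]
    ring
  · have : (fun x => (x, m)) ⁻¹' (N.received ⁻¹' (s ×ˢ C)) = ∅ := by
      ext x
      simp [received, hmC]
    rw [this, measure_empty, Set.indicator_of_notMem hmC, zero_mul, mul_zero]

theorem hasPoissonPGFL_powerThreshold [IsProbabilityMeasure μ] (hmoment : N.moment < ∞) :
    HasPoissonPGFL μ N.powerThreshold (N.powerIntensity.prod N.thresholdLaw) := by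
  have := N.isProbabilityMeasure_markLaw
  rw [← N.map_received hmoment]
  exact (N.poisson.hasPoissonPGFL.marked N.poisson.measurable
    (fun i => (N.measurable_S i).prodMk ((N.measurable_P i).prodMk (N.measurable_T i)))
    (fun i => (N.marks_law i).map_eq) N.marks_indep N.marks_indep_X).map N.measurable_received

theorem ae_marks_pos : ∀ᵐ ω ∂μ, ∀ i, 0 < N.S i ω ∧ 0 < N.P i ω ∧ 0 < N.T i ω := by
  refine ae_all_iff.2 fun i => ?_
  have h := N.marks_pos
  rw [← (N.marks_law i).map_eq] at h
  exact ae_of_ae_map (N.marks_law i).aemeasurable h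

theorem ae_position_ne_zero [IsProbabilityMeasure μ] : ∀ᵐ ω ∂μ, ∀ i, N.X i ω ≠ 0 := by
  have h0 : (ENNReal.ofReal N.dens • volume : Measure (EuclideanSpace ℝ (Fin 2))) {0} = 0 := by
    rw [Measure.smul_apply, measure_singleton, smul_zero]
  have h1 := N.poisson.poisson {0} (measurableSet_singleton _) (by rw [h0]; simp) 0
  rw [h0] at h1
  have h2 : μ {ω | pointCount N.X {0} ω = 0} = 1 := by
    simpa [poissonMeasure_singleton] using h1
  have hm : MeasurableSet {ω | pointCount N.X {0} ω = 0} :=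
    measurable_pointCount N.poisson.measurable (measurableSet_singleton _)
      (measurableSet_singleton 0)
  filter_upwards [(mem_ae_iff_prob_eq_one hm).2 h2] with ω hω i hi
  have : i ∈ {i | N.X i ω ∈ ({0} : Set (EuclideanSpace ℝ (Fin 2)))} := hi
  rw [Set.encard_eq_zero.1 hω] at this
  exact this

theorem ae_inv_loss_pos [IsProbabilityMeasure μ] : ∀ᵐ ω ∂μ, ∀ i, 0 < (N.loss i ω)⁻¹ := by
  filter_upwards [N.ae_marks_pos, N.ae_position_ne_zero] with ω hm hx i
  exact inv_pos.2 (div_pos (Real.rpow_pos_of_pos (mul_pos N.K_pos (norm_pos_iff.2 (hx i))) _)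
    (mul_pos (hm i).2.1 (hm i).1))

theorem lintegral_min_fst_ne_top [IsProbabilityMeasure μ] (hmoment : N.moment < ∞) :
    ∫⁻ q, min 1 (q.1 : ℝ≥0∞) ∂(N.powerIntensity.prod N.thresholdLaw) ≠ ∞ := by
  have := N.isProbabilityMeasure_thresholdLaw hmoment
  have := N.sigmaFinite_powerIntensity hmoment
  rw [lintegral_prod _ (by fun_prop)]
  simpa using N.lintegral_min_powerIntensity_ne_top hmoment

/-- The total received power is almost surely finite. -/
theorem ae_summable_inv_loss [IsProbabilityMeasure μ] (hmoment : N.moment < ∞) :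
    ∀ᵐ ω ∂μ, Summable fun i => (N.loss i ω)⁻¹ := by
  filter_upwards [(N.hasPoissonPGFL_powerThreshold hmoment).ae_summable
    N.measurable_powerThreshold (V := Prod.fst) measurable_fst
    (N.lintegral_min_fst_ne_top hmoment), N.ae_inv_loss_pos] with ω hω hpos
  refine hω.congr fun i => ?_
  exact Real.coe_toNNReal _ (hpos i).le

/-- The Mecke formula for the received powers and thresholds. -/
theorem reducedCampbell_powerThreshold [IsProbabilityMeasure μ] (hmoment : N.moment < ∞)
    (n : ℕ) :
    reducedCampbell μ N.powerThreshold Prod.fst n =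
      (Measure.pi fun _ => N.powerIntensity.prod N.thresholdLaw).prod
        (μ.map (shotNoise N.powerThreshold Prod.fst)) := by
  have := N.isProbabilityMeasure_thresholdLaw hmoment
  have := N.sigmaFinite_powerIntensity hmoment
  refine (N.hasPoissonPGFL_powerThreshold hmoment).reducedCampbell_eq
    N.measurable_powerThreshold measurable_fst (N.lintegral_min_fst_ne_top hmoment)
    (Measure.quasiMeasurePreserving_fst.ae N.ae_powerIntensity_ne_zero) ?_ n
  filter_upwards [N.ae_inv_loss_pos] with ω hω i
  exact (Real.toNNReal_pos.2 (hω i)).ne'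

end HetNetwork

/-! ### Symmetric sums and factorial moment measures -/

/-- A sum over ordered `n`-tuples of distinct indices that depends only on the underlying set
counts every `n`-element set `n!` times. -/
theorem tsum_embedding_eq_factorial_mul (n : ℕ) (f : Finset ℕ → ℝ≥0∞) :
    ∑' e : Fin n ↪ ℕ, f (Finset.univ.map e) =
      n.factorial * ∑' s : {s : Finset ℕ // s.card = n}, f s.1 := by
  let toSet : (Fin n ↪ ℕ) → {s : Finset ℕ // s.card = n} := fun e =>
    ⟨Finset.univ.map e, by simp⟩
  rw [← (Equiv.sigmaFiberEquiv toSet).tsum_eq, ENNReal.tsum_sigma', ← ENNReal.tsum_mul_left]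
  refine tsum_congr fun s => ?_
  have hmap : ∀ e : {e // toSet e = s}, Finset.univ.map e.1 = s.1 := fun e =>
    congrArg Subtype.val e.2
  have hconst : ∀ e : {e // toSet e = s}, f (Finset.univ.map e.1) = f s.1 := fun e =>
    congrArg f (hmap e)
  have hcard : ENat.card {e // toSet e = s} = n.factorial := by
    let E : (Fin n ≃ s.1) ≃ {e // toSet e = s} :=
      { toFun := fun σ => ⟨σ.toEmbedding.trans (Function.Embedding.subtype _), by
          refine Subtype.ext (Finset.ext fun i => ?_)
          simp only [toSet, Finset.mem_map, Finset.mem_univ, true_and]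
          constructor
          · rintro ⟨k, rfl⟩
            exact (σ k).2
          · intro hi
            exact ⟨σ.symm ⟨i, hi⟩, by simp⟩⟩
        invFun := fun e => Equiv.ofBijective
          (fun k => ⟨e.1 k, hmap e ▸ Finset.mem_map_of_mem _ (Finset.mem_univ k)⟩)
          ⟨fun k l hkl => e.1.injective (Subtype.ext_iff.1 hkl), fun ⟨i, hi⟩ => by
            rw [← hmap e] at hi
            obtain ⟨k, -, hk⟩ := Finset.mem_map.1 hi
            exact ⟨k, Subtype.ext hk⟩⟩
        left_inv := fun σ => by ext k; rfl
        right_inv := fun e => by ext k; rfl }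
    have hF : Fintype.card (Fin n) = Fintype.card s.1 := by simp [s.2]
    rw [← ENat.card_congr E, ENat.card_eq_coe_fintype_card,
      Fintype.card_equiv (Fintype.equivOfCardEq hF), Fintype.card_fin]
  change ∑' e : {e // toSet e = s}, f (Finset.univ.map e.1) = _
  simp_rw [hconst]
  rw [ENNReal.tsum_const, hcard]
  rfl

theorem indicator_const_eq_of_mem_iff {α β M : Type*} [Zero M] {s : Set α} {t : Set β} {a : α}
    {b : β} (h : a ∈ s ↔ b ∈ t) (c : M) :
    s.indicator (fun _ => c) a = t.indicator (fun _ => c) b := by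
  by_cases ha : a ∈ s
  · rw [Set.indicator_of_mem ha, Set.indicator_of_mem (h.1 ha)]
  · rw [Set.indicator_of_notMem ha, Set.indicator_of_notMem fun hb => ha (h.2 hb)]

namespace HetNetwork

variable {Ω : Type*} [MeasurableSpace Ω] {μ : Measure Ω} (N : HetNetwork μ)

/-- The SINR of the `k`-th of `n` stations with received powers `v`, when the power received from
all other stations is `r`. -/
noncomputable def tupleSinr {n : ℕ} (v : Fin n → ℝ≥0) (r : ℝ) (k : Fin n) : ℝ :=
  (v k : ℝ) / (N.W + N.γ * (∑ j, (v j : ℝ) + r - v k))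

theorem measurable_tupleSinr {n : ℕ} :
    Measurable fun q : (Fin n → ℝ≥0) × ℝ => N.tupleSinr q.1 q.2 := by
  unfold tupleSinr
  fun_prop

/-- The properties of a realization that hold almost surely: every station is received with
positive power, and the total power is finite. -/
def IsRegular (N : HetNetwork μ) (ω : Ω) : Prop :=
  (∀ i, 0 < (N.loss i ω)⁻¹) ∧ Summable fun i => (N.loss i ω)⁻¹

theorem ae_isRegular [IsProbabilityMeasure μ] (hmoment : N.moment < ∞) :
    ∀ᵐ ω ∂μ, N.IsRegular ω := N.ae_inv_loss_pos.and (N.ae_summable_inv_loss hmoment)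

variable {N}

theorem IsRegular.coe_power {ω : Ω} (h : N.IsRegular ω) (i : ℕ) :
    ((N.powerThreshold i ω).1 : ℝ) = (N.loss i ω)⁻¹ := Real.coe_toNNReal _ (h.1 i).le

theorem IsRegular.shotNoise_eq {ω : Ω} (h : N.IsRegular ω) :
    shotNoise N.powerThreshold Prod.fst ω = N.totalPower ω :=
  tsum_congr fun i => h.coe_power i

theorem IsRegular.tupleSinr_eq {ω : Ω} (h : N.IsRegular ω) {n : ℕ} (e : Fin n ↪ ℕ) (k : Fin n) :
    N.tupleSinr (fun j => ((tupleAndRest N.powerThreshold Prod.fst e ω).1 j).1)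
      (tupleAndRest N.powerThreshold Prod.fst e ω).2 k = N.sinr (e k) ω := by
  simp only [tupleSinr, tupleAndRest, h.shotNoise_eq, add_sub_cancel, h.coe_power, sinr]

theorem IsRegular.totalPower_gt {ω : Ω} (h : N.IsRegular ω) (i : ℕ) :
    (N.loss i ω)⁻¹ < N.totalPower ω := by
  have h1 := h.2.sum_le_tsum {i, i + 1} fun j _ => (h.1 j).le
  rw [Finset.sum_pair (by simp)] at h1
  have h2 := h.1 (i + 1)
  unfold totalPower
  linarith

/-- The SINR exceeds `t` exactly when the STINR exceeds `t / (1 + γ t)`. -/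
theorem IsRegular.lt_sinr_iff {ω : Ω} (h : N.IsRegular ω) (hdenom : 0 < N.W ∨ 0 < N.γ) (i : ℕ)
    {t : ℝ} (ht : 0 < t) : t < N.sinr i ω ↔ t / (1 + N.γ * t) < N.stinr i ω := by
  have hI := h.totalPower_gt i
  have hv := h.1 i
  have hW := N.W_nonneg
  have hγ := N.γ_nonneg
  -- when `W = 0`, positivity of the interference comes from the other stations
  have hD : 0 < N.W + N.γ * (N.totalPower ω - (N.loss i ω)⁻¹) := by
    have h1 := sub_pos.2 hI
    rcases hdenom with h0 | h0 <;> positivity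
  have hD' : 0 < N.W + N.γ * N.totalPower ω := by
    have h1 := hv.trans hI
    rcases hdenom with h0 | h0 <;> positivity
  have h1 : 0 < 1 + N.γ * t := by positivity
  rw [sinr, stinr, lt_div_iff₀ hD, div_lt_div_iff₀ h1 hD']
  constructor <;> intro hlt <;> linarith

variable (N)

theorem factorialMoment_sinr_eq [IsProbabilityMeasure μ] (hmoment : N.moment < ∞)
    (hdenom : 0 < N.W ∨ 0 < N.γ) {n : ℕ} {t : Fin n → ℝ} (ht : ∀ k, 0 < t k) :
    factorialMoment μ N.sinr n t =
      factorialMoment μ N.stinr n fun k => t k / (1 + N.γ * t k) := by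
  have hm : ∀ s : Fin n → ℝ, MeasurableSet {z : Fin n → ℝ | ∀ k, s k < z k} := fun s => by
    rw [Set.ofPred_forall]
    exact MeasurableSet.iInter fun k => measurableSet_lt measurable_const (measurable_pi_apply k)
  rw [factorialMoment, factorialMoment, factorialMomentMeasure_apply μ _ N.measurable_sinr n (hm _),
    factorialMomentMeasure_apply μ _ N.measurable_stinr n (hm _)]
  refine lintegral_congr_ae ?_
  filter_upwards [N.ae_isRegular hmoment] with ω hω
  refine tsum_congr fun e => ?_
  refine indicator_const_eq_of_mem_iff ?_ 1
  exact forall_congr' fun k => hω.lt_sinr_iff hdenom (e k) (ht k)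

theorem measurableSet_threshold_lt {n : ℕ} :
    MeasurableSet {p : (Fin n → ℝ≥0 × ℝ) × ℝ |
      ∀ k, (p.1 k).2 < N.tupleSinr (fun j => (p.1 j).1) p.2 k} := by
  rw [Set.ofPred_forall]
  refine MeasurableSet.iInter fun k => measurableSet_lt (by fun_prop) ?_
  exact (measurable_pi_apply k).comp (N.measurable_tupleSinr.comp
    (by fun_prop : Measurable fun p : (Fin n → ℝ≥0 × ℝ) × ℝ => ((fun j => (p.1 j).1), p.2)))

/-- `n! 𝒮ₙ` as the measure of an event under the reduced Campbell measure. -/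
theorem factorial_mul_symmetricSum [IsProbabilityMeasure μ] (hmoment : N.moment < ∞) (n : ℕ) :
    n.factorial * N.symmetricSum n =
      reducedCampbell μ N.powerThreshold Prod.fst n {p : (Fin n → ℝ≥0 × ℝ) × ℝ |
        ∀ k, (p.1 k).2 < N.tupleSinr (fun j => (p.1 j).1) p.2 k} := by
  have hset := N.measurableSet_threshold_lt (n := n)
  have hmeas : ∀ s : Finset ℕ, MeasurableSet {ω | ∀ i ∈ s, N.T i ω < N.sinr i ω} := fun s => by
    have : {ω | ∀ i ∈ s, N.T i ω < N.sinr i ω} = ⋂ i ∈ s, {ω | N.T i ω < N.sinr i ω} := by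
      ext; simp
    rw [this]
    exact Finset.measurableSet_biInter s fun i _ =>
      measurableSet_lt (N.measurable_T i) (N.measurable_sinr i)
  rw [← lintegral_indicator_one hset, lintegral_reducedCampbell N.measurable_powerThreshold
    measurable_fst (measurable_one.indicator hset), symmetricSum,
    ← lintegral_const_mul' _ _ (ENNReal.natCast_ne_top _)]
  simp_rw [fun ω => (tsum_embedding_eq_factorial_mul n fun s =>
    {ω' | ∀ i ∈ s, N.T i ω' < N.sinr i ω'}.indicator (fun _ => (1 : ℝ≥0∞)) ω).symm]
  rw [lintegral_tsum fun e => (measurable_const.indicator (hmeas _)).aemeasurable]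
  refine tsum_congr fun e => lintegral_congr_ae ?_
  filter_upwards [N.ae_isRegular hmoment] with ω hω
  have hiff : (∀ i ∈ Finset.univ.map e, N.T i ω < N.sinr i ω) ↔
      tupleAndRest N.powerThreshold Prod.fst e ω ∈ {p : (Fin n → ℝ≥0 × ℝ) × ℝ |
        ∀ k, (p.1 k).2 < N.tupleSinr (fun j => (p.1 j).1) p.2 k} := by
    rw [Set.mem_ofPred_eq]
    simp_rw [hω.tupleSinr_eq e]
    simp [tupleAndRest, powerThreshold]
  refine indicator_const_eq_of_mem_iff ?_ 1
  exact hiff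

theorem lintegral_factorialMomentMeasure_sinr [IsProbabilityMeasure μ] (hmoment : N.moment < ∞)
    {n : ℕ} {g : (Fin n → ℝ) → ℝ≥0∞} (hg : Measurable g) :
    ∫⁻ z, g z ∂(factorialMomentMeasure μ N.sinr n) =
      ∫⁻ p, g (N.tupleSinr (fun j => (p.1 j).1) p.2)
        ∂(reducedCampbell μ N.powerThreshold Prod.fst n) := by
  have hm : Measurable fun p : (Fin n → ℝ≥0 × ℝ) × ℝ =>
      N.tupleSinr (fun j => (p.1 j).1) p.2 :=
    N.measurable_tupleSinr.comp
      (by fun_prop : Measurable fun p : (Fin n → ℝ≥0 × ℝ) × ℝ => ((fun j => (p.1 j).1), p.2))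
  have hgm : Measurable fun p : (Fin n → ℝ≥0 × ℝ) × ℝ =>
      g (N.tupleSinr (fun j => (p.1 j).1) p.2) := hg.comp hm
  rw [lintegral_reducedCampbell N.measurable_powerThreshold measurable_fst hgm,
    factorialMomentMeasure, lintegral_sum_measure]
  refine tsum_congr fun e => ?_
  rw [lintegral_map hg (measurable_pi_lambda _ fun k => N.measurable_sinr (e k))]
  refine lintegral_congr_ae ?_
  filter_upwards [N.ae_isRegular hmoment] with ω hω
  congr 1
  ext k
  exact (hω.tupleSinr_eq e k).symm

/-- Integration against the reduced Campbell measure: powers, thresholds and remaining power can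
be integrated one after the other. -/
theorem lintegral_reducedCampbell_powerThreshold [IsProbabilityMeasure μ] (hmoment : N.moment < ∞)
    {n : ℕ} {g : (Fin n → ℝ≥0) × (Fin n → ℝ) → ℝ → ℝ≥0∞} (hg : Measurable (Function.uncurry g)) :
    ∫⁻ p, g (fun k => (p.1 k).1, fun k => (p.1 k).2) p.2
        ∂(reducedCampbell μ N.powerThreshold Prod.fst n) =
      ∫⁻ r, ∫⁻ v, ∫⁻ t, g (v, t) r ∂(Measure.pi fun _ => N.thresholdLaw)
        ∂(Measure.pi fun _ => N.powerIntensity)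
          ∂(μ.map (shotNoise N.powerThreshold Prod.fst)) := by
  have := N.isProbabilityMeasure_thresholdLaw hmoment
  have := N.sigmaFinite_powerIntensity hmoment
  have := Measure.isProbabilityMeasure_map (μ := μ)
    (measurable_shotNoise N.measurable_powerThreshold (V := Prod.fst) measurable_fst).aemeasurable
  have hgm : Measurable fun p : (Fin n → ℝ≥0 × ℝ) × ℝ =>
      g (fun k => (p.1 k).1, fun k => (p.1 k).2) p.2 :=
    hg.comp (by fun_prop : Measurable fun p : (Fin n → ℝ≥0 × ℝ) × ℝ =>
      (((fun k => (p.1 k).1), fun k => (p.1 k).2), p.2))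
  rw [N.reducedCampbell_powerThreshold hmoment, lintegral_prod_symm _ hgm.aemeasurable]
  refine lintegral_congr fun r => ?_
  have hgr : Measurable fun q => g q r := hg.comp measurable_prodMk_right
  rw [← lintegral_prod _ hgr.aemeasurable,
    ← (measurePreserving_arrowProdEquivProdArrow ℝ≥0 ℝ (Fin n) (fun _ => N.powerIntensity)
      fun _ => N.thresholdLaw).lintegral_comp hgr]
  rfl

theorem measurable_thresholdLaw_Iio [IsProbabilityMeasure μ] (hmoment : N.moment < ∞) :
    Measurable fun c : ℝ => N.thresholdLaw (Set.Iio c) := by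
  have := N.isProbabilityMeasure_thresholdLaw hmoment
  exact Monotone.measurable fun a b hab => measure_mono (Set.Iio_subset_Iio hab)

/-- Averaging over the thresholds, which by the Mecke formula are independent of the SINR values
and distributed as `T*`. -/
theorem factorial_mul_symmetricSum_eq_lintegral [IsProbabilityMeasure μ]
    (hmoment : N.moment < ∞) (n : ℕ) :
    n.factorial * N.symmetricSum n =
      ∫⁻ z, ∏ k, N.thresholdLaw (Set.Iio (z k)) ∂(factorialMomentMeasure μ N.sinr n) := by
  have := N.isProbabilityMeasure_thresholdLaw hmoment
  have hF := N.measurable_thresholdLaw_Iio hmoment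
  have hgF : Measurable fun z : Fin n → ℝ => ∏ k, N.thresholdLaw (Set.Iio (z k)) :=
    Finset.measurable_fun_prod _ fun k _ => hF.comp (measurable_pi_apply k)
  rw [N.factorial_mul_symmetricSum hmoment, N.lintegral_factorialMomentMeasure_sinr hmoment hgF,
    ← lintegral_indicator_one N.measurableSet_threshold_lt]
  have hS : MeasurableSet {q : ((Fin n → ℝ≥0) × (Fin n → ℝ)) × ℝ |
      ∀ k, q.1.2 k < N.tupleSinr q.1.1 q.2 k} := by
    rw [Set.ofPred_forall]
    refine MeasurableSet.iInter fun k => measurableSet_lt (by fun_prop) ?_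
    exact (measurable_pi_apply k).comp (N.measurable_tupleSinr.comp
      (by fun_prop : Measurable fun q : ((Fin n → ℝ≥0) × (Fin n → ℝ)) × ℝ => (q.1.1, q.2)))
  have h1 := N.lintegral_reducedCampbell_powerThreshold hmoment (n := n)
    (g := fun q r => {q : ((Fin n → ℝ≥0) × (Fin n → ℝ)) × ℝ |
      ∀ k, q.1.2 k < N.tupleSinr q.1.1 q.2 k}.indicator 1 (q, r)) (measurable_one.indicator hS)
  have h2 := N.lintegral_reducedCampbell_powerThreshold hmoment (n := n)
    (g := fun q r => ∏ k, N.thresholdLaw (Set.Iio (N.tupleSinr q.1 r k)))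
    (hgF.comp (N.measurable_tupleSinr.comp
      (by fun_prop : Measurable fun q : ((Fin n → ℝ≥0) × (Fin n → ℝ)) × ℝ => (q.1.1, q.2))))
  refine h1.trans (Eq.trans ?_ h2.symm)
  refine lintegral_congr fun r => lintegral_congr fun v => ?_
  simp only [lintegral_const, measure_univ, mul_one]
  rw [← Measure.pi_pi,
    ← lintegral_indicator_one (MeasurableSet.univ_pi fun k => measurableSet_Iio)]
  refine lintegral_congr fun t => ?_
  exact indicator_const_eq_of_mem_iff (by simp) 1

/-- A single SINR value has no atoms in `(0, ∞)`: given the power of the other stations, the SINR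
takes a given value for at most one value of the received power. -/
theorem measure_sinr_eq [IsProbabilityMeasure μ] (hmoment : N.moment < ∞) (i : ℕ) {c : ℝ}
    (hc : 0 < c) : μ {ω | N.sinr i ω = c} = 0 := by
  have := N.isProbabilityMeasure_thresholdLaw hmoment
  have := N.sigmaFinite_powerIntensity hmoment
  have hset : MeasurableSet {z : Fin 1 → ℝ | z 0 = c} :=
    measurableSet_eq_fun (measurable_pi_apply 0) measurable_const
  have hzero : factorialMomentMeasure μ N.sinr 1 {z | z 0 = c} = 0 := by
    rw [← lintegral_indicator_one hset, N.lintegral_factorialMomentMeasure_sinr hmoment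
      (measurable_one.indicator hset)]
    have hm : Measurable fun q : ((Fin 1 → ℝ≥0) × (Fin 1 → ℝ)) × ℝ =>
        N.tupleSinr q.1.1 q.2 := N.measurable_tupleSinr.comp
      (by fun_prop : Measurable fun q : ((Fin 1 → ℝ≥0) × (Fin 1 → ℝ)) × ℝ => (q.1.1, q.2))
    have h1 := N.lintegral_reducedCampbell_powerThreshold hmoment (n := 1)
      (g := fun q r => {z : Fin 1 → ℝ | z 0 = c}.indicator 1 (N.tupleSinr q.1 r))
      ((measurable_one.indicator hset).comp hm)
    refine h1.trans ?_
    rw [lintegral_congr (g := fun _ => 0) fun r => ?_, lintegral_zero]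
    rw [lintegral_congr_ae (g := fun _ => 0), lintegral_zero]
    have hae : ∀ᵐ v ∂(Measure.pi fun _ : Fin 1 => N.powerIntensity),
        v 0 ≠ (c * (N.W + N.γ * r)).toNNReal :=
      (Measure.quasiMeasurePreserving_eval (fun _ : Fin 1 => N.powerIntensity) 0).ae
        (p := fun x => x ≠ (c * (N.W + N.γ * r)).toNNReal) (by
          rw [ae_iff]
          simpa using N.powerIntensity_singleton _)
    filter_upwards [hae] with v hv
    have hne : N.tupleSinr v r 0 ≠ c := fun h => by
      simp only [tupleSinr, Finset.univ_unique, Fin.default_eq_zero, Finset.sum_singleton,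
        add_sub_cancel_left] at h
      -- a vanishing denominator would give the quotient `0`, which is not `c`
      have hd : N.W + N.γ * r ≠ 0 := fun h0 => by
        rw [h0, div_zero] at h
        exact hc.ne h
      rw [div_eq_iff hd] at h
      exact hv (by rw [← h, Real.toNNReal_coe])
    rw [Set.indicator_of_notMem (show N.tupleSinr v r ∉ {z : Fin 1 → ℝ | z 0 = c} from hne)]
    simp
  rw [factorialMomentMeasure, Measure.sum_apply _ hset, ENNReal.tsum_eq_zero] at hzero
  have := hzero ⟨fun _ => i, fun a b _ => Subsingleton.elim a b⟩
  rwa [Measure.map_apply (measurable_pi_lambda _ fun k => N.measurable_sinr _) hset] at this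

theorem ae_factorialMomentMeasure_ne [IsProbabilityMeasure μ] (hmoment : N.moment < ∞) {n : ℕ}
    (k : Fin n) {c : ℝ} (hc : 0 < c) :
    ∀ᵐ z ∂(factorialMomentMeasure μ N.sinr n), z k ≠ c := by
  have hset : MeasurableSet {z : Fin n → ℝ | z k ≠ c} :=
    (measurableSet_eq_fun (measurable_pi_apply k) measurable_const).compl
  rw [factorialMomentMeasure, Measure.ae_sum_iff' hset]
  intro e
  rw [ae_map_iff (measurable_pi_lambda _ fun k => N.measurable_sinr _).aemeasurable hset, ae_iff]
  simpa using N.measure_sinr_eq hmoment (e k) hc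

/-- For almost every value of the SINR process the distribution function `F_{T*}` has no jump:
it has only countably many jumps, and none of them is an atom of the SINR process. -/
theorem ae_thresholdCDF_eq [IsProbabilityMeasure μ] (hmoment : N.moment < ∞) {n : ℕ} :
    ∀ᵐ z ∂(factorialMomentMeasure μ N.sinr n), ∀ k, 0 < z k →
      N.thresholdCDF (z k) = N.thresholdLaw (Set.Iio (z k)) := by
  have := N.isProbabilityMeasure_thresholdLaw hmoment
  have hcount : {c : ℝ | 0 < N.thresholdLaw {c}}.Countable :=
    Measure.countable_meas_pos_of_disjoint_iUnion (μ := N.thresholdLaw)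
      (fun c => measurableSet_singleton c)
      fun a b hab => Set.disjoint_singleton.2 hab
  have hcount' : ({c : ℝ | 0 < N.thresholdLaw {c}} ∩ Set.Ioi 0).Countable :=
    hcount.mono Set.inter_subset_left
  refine ae_all_iff.2 fun k => ?_
  have hae : ∀ᵐ z ∂(factorialMomentMeasure μ N.sinr n),
      ∀ c ∈ {c : ℝ | 0 < N.thresholdLaw {c}} ∩ Set.Ioi 0, z k ≠ c :=
    (ae_ball_iff hcount').2 fun c hc => N.ae_factorialMomentMeasure_ne hmoment k hc.2
  filter_upwards [hae] with z hz hpos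
  have hatom : N.thresholdLaw {z k} = 0 := by
    by_contra h0
    exact hz (z k) ⟨pos_iff_ne_zero.2 h0, hpos⟩ rfl
  rw [← N.thresholdLaw_Iic, ← Set.Iio_union_right]
  exact le_antisymm ((measure_union_le _ _).trans (by rw [hatom, add_zero]))
    (measure_mono Set.subset_union_left)

theorem thresholdLaw_Iio_of_nonpos {c : ℝ} (hc : c ≤ 0) : N.thresholdLaw (Set.Iio c) = 0 :=
  measure_mono_null (fun _ hx => (show _ < c from hx).le.trans hc) N.thresholdLaw_Iic_zero

theorem measurableSet_pos {n : ℕ} : MeasurableSet {t : Fin n → ℝ | ∀ k, 0 < t k} := by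
  rw [Set.ofPred_forall]
  exact MeasurableSet.iInter fun k => measurableSet_lt measurable_const (measurable_pi_apply k)

/-- The factors with `z k ≤ 0` vanish, since `T*` is positive, so the restriction to `(0, ∞)ⁿ` can
be dropped. -/
theorem lintegral_prod_thresholdCDF [IsProbabilityMeasure μ] (hmoment : N.moment < ∞) (n : ℕ) :
    ∫⁻ t in {t : Fin n → ℝ | ∀ k, 0 < t k}, ∏ k, N.thresholdCDF (t k)
        ∂(factorialMomentMeasure μ N.sinr n) =
      ∫⁻ z, ∏ k, N.thresholdLaw (Set.Iio (z k)) ∂(factorialMomentMeasure μ N.sinr n) := by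
  rw [← lintegral_indicator measurableSet_pos]
  refine lintegral_congr_ae ?_
  filter_upwards [N.ae_thresholdCDF_eq hmoment] with z hz
  by_cases hpos : ∀ k, 0 < z k
  · rw [Set.indicator_of_mem (show z ∈ {t : Fin n → ℝ | ∀ k, 0 < t k} from hpos)]
    exact Finset.prod_congr rfl fun k _ => hz k (hpos k)
  · rw [Set.indicator_of_notMem (show z ∉ {t : Fin n → ℝ | ∀ k, 0 < t k} from hpos)]
    obtain ⟨k, hk⟩ := not_forall.1 hpos
    exact (Finset.prod_eq_zero (Finset.mem_univ k)
      (N.thresholdLaw_Iio_of_nonpos (not_lt.1 hk))).symm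

theorem lintegral_factorialMoment [IsProbabilityMeasure μ] (hmoment : N.moment < ∞) (n : ℕ) :
    ∫⁻ t in {t : Fin n → ℝ | ∀ k, 0 < t k}, factorialMoment μ N.sinr n t
        ∂(Measure.pi fun _ => N.thresholdLaw) =
      ∫⁻ z, ∏ k, N.thresholdLaw (Set.Iio (z k)) ∂(factorialMomentMeasure μ N.sinr n) := by
  have := N.isProbabilityMeasure_thresholdLaw hmoment
  have hsf : SFinite (factorialMomentMeasure μ N.sinr n) := by
    unfold factorialMomentMeasure
    infer_instance
  have hpos : ∀ᵐ t ∂(Measure.pi fun _ : Fin n => N.thresholdLaw), ∀ k, 0 < t k :=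
    ae_all_iff.2 fun k =>
      (Measure.quasiMeasurePreserving_eval (fun _ : Fin n => N.thresholdLaw) k).ae
        (p := fun x => 0 < x) (by
          rw [ae_iff]
          simpa [Set.Iic] using N.thresholdLaw_Iic_zero)
  have hS : MeasurableSet {q : (Fin n → ℝ) × (Fin n → ℝ) | ∀ k, q.1 k < q.2 k} := by
    rw [Set.ofPred_forall]
    exact MeasurableSet.iInter fun k => measurableSet_lt (by fun_prop) (by fun_prop)
  rw [Measure.restrict_eq_self_of_ae_mem (s := {t : Fin n → ℝ | ∀ k, 0 < t k}) hpos]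
  have h1 : ∀ t : Fin n → ℝ, factorialMoment μ N.sinr n t =
      ∫⁻ z, {q : (Fin n → ℝ) × (Fin n → ℝ) | ∀ k, q.1 k < q.2 k}.indicator 1 (t, z)
        ∂(factorialMomentMeasure μ N.sinr n) := fun t => by
    exact (lintegral_indicator_one (hS.preimage measurable_prodMk_left)).symm
  simp_rw [h1]
  have hSm : Measurable (Function.uncurry fun t z : Fin n → ℝ =>
      {q : (Fin n → ℝ) × (Fin n → ℝ) | ∀ k, q.1 k < q.2 k}.indicator
        (1 : (Fin n → ℝ) × (Fin n → ℝ) → ℝ≥0∞) (t, z)) :=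
    measurable_one.indicator hS
  rw [lintegral_lintegral_swap hSm.aemeasurable]
  refine lintegral_congr fun z => ?_
  rw [← Measure.pi_pi, ← lintegral_indicator_one (MeasurableSet.univ_pi fun k => measurableSet_Iio)]
  refine lintegral_congr fun t => ?_
  exact indicator_const_eq_of_mem_iff (by simp) 1

end HetNetwork

theorem mainTheorem4 {Ω : Type*} [MeasurableSpace Ω] (μ : Measure Ω) [IsProbabilityMeasure μ]
    (N : HetNetwork μ)
    (hmoment : N.moment < ∞)
    (hdenom : 0 < N.W ∨ 0 < N.γ)
    (n : ℕ) (hn : 1 ≤ n) :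
    (∀ᵐ ω ∂μ, Summable fun i => (N.loss i ω)⁻¹) ∧
    N.symmetricSum n = (n.factorial : ℝ≥0∞)⁻¹ *
      ∫⁻ t in {t : Fin n → ℝ | ∀ k, 0 < t k}, ∏ k, N.thresholdCDF (t k)
        ∂(factorialMomentMeasure μ N.sinr n) ∧
    N.symmetricSum n = (n.factorial : ℝ≥0∞)⁻¹ *
      ∫⁻ t in {t : Fin n → ℝ | ∀ k, 0 < t k}, factorialMoment μ N.sinr n t
        ∂(Measure.pi fun _ => N.thresholdLaw) ∧
    ∀ t : Fin n → ℝ, (∀ k, 0 < t k) →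
      factorialMoment μ N.sinr n t =
        factorialMoment μ N.stinr n fun k => t k / (1 + N.γ * t k) := by
  have hfact : N.symmetricSum n = (n.factorial : ℝ≥0∞)⁻¹ *
      ∫⁻ z, ∏ k, N.thresholdLaw (Set.Iio (z k)) ∂(factorialMomentMeasure μ N.sinr n) := by
    rw [← N.factorial_mul_symmetricSum_eq_lintegral hmoment, ← mul_assoc,
      ENNReal.inv_mul_cancel (by exact_mod_cast n.factorial_ne_zero) (ENNReal.natCast_ne_top _),
      one_mul]
  refine ⟨N.ae_summable_inv_loss hmoment, ?_, ?_,
    fun t ht => N.factorialMoment_sinr_eq hmoment hdenom ht⟩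
  · rw [N.lintegral_prod_thresholdCDF hmoment, hfact]
  · rw [N.lintegral_factorialMoment hmoment, hfact]
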